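/- Let $S^1\times GL_2(\mathbb C)$ act on $\mathbb C^{2\times 2}$ by $((c,P),A)\mapsto cP^*AP$. Write $\mathrm{Orb}(A)$ for the orbit of $A$, and $\widetilde A\to A$ (a path) if $\mathrm{Orb}(\widetilde A)\subseteq\overline{\mathrm{Orb}(A)}$. The closure graph has the orbits as vertices and the paths as edges. Let $\|X\|=\max_{j,k}|x_{jk}|$, let $a\oplus d$ be the diagonal matrix with entries $a,d$, and let $0_2$, $I_2$ be the zero and the identity matrix. The dimension of an orbit (an immersed real submanifold) is the real rank of the orbit map $(c,P)\mapsto cP^*AP$. **Closure graph.** Every orbit contains exactly one of the following normal forms ($0<\theta<\pi$, $0<\tau<1$), and the dimension of its orbit is as indicated: - dimension 7: $1\oplus e^{i\theta}$, $\begin{bmatrix}0&1\\ \tau&0\end{bmatrix}$, $\begin{bmatrix}0&1\\1&i\end{bmatrix}$; - dimension 6: $\begin{bmatrix}0&1\\0&0\end{bmatrix}$; - dimension 5: $1\oplus -1$ and $I_2$; - dimension 4: $1\oplus 0$; - dimension 0: $0_2$. The paths between them are exactly those obtained by reflexivity and transitivity from $$0_2\to 1\oplus 0,\qquad 1\oplus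 -1\to\begin{bmatrix}0&1\\1&i\end{bmatrix},\qquad 1\oplus 0\to V,$$ where $V$ is any of $1\oplus -1$, $I_2$, $\begin{bmatrix}0&1\\0&0\end{bmatrix}$, $1\oplus e^{i\theta}$, $\begin{bmatrix}0&1\\ \tau&0\end{bmatrix}$, $\begin{bmatrix}0&1\\1&i\end{bmatrix}$ ($0<\theta<\pi$, $0<\tau<1$). Moreover $\begin{bmatrix}0&1\\1&0\end{bmatrix}$ lies in the orbit of $1\oplus -1$. **Estimates.** For $c\in S^1$ and $P=\begin{bmatrix}x&y\\u&v\end{bmatrix}\in GL_2(\mathbb C)$ put $E=cP^*AP-\widetilde A$. 1. Let each of $\widetilde A$, $A$ be one of the normal forms above or $\begin{bmatrix}0&1\\1&0\end{bmatrix}$. If $\widetilde A\not\to A$, there is a constant $\mu>0$ with $\|E\|\ge\mu$ for all $c,P$. 2. Let $\widetilde A,A$ be as in one of the lines (C1)–(C10) below, and let $\widetilde A\to A$. Then there is a constant $\nu>0$ such that for all $c,P$ (with $\|E\|\le\frac{|\det\widetilde A|}{8\|\widetilde A\|+4}$ if $A$ and $\widetilde A$ are both nonsingular) the moduli of the expressions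 of the line are at most $\nu\|E\|$; where $k$ occurs, this holds for some $k\in\mathbb Z$ (depending on $c,P$, and the same for all expressions listed together). - (C1) $\widetilde A=\alpha\oplus0$, $A=1\oplus e^{i\theta}$, $\alpha\in\{0,1\}$, $0\le\theta<\pi$: $|x|^2+e^{i\theta}|u|^2-c^{-1}\alpha$, $y^2$, $v^2$. - (C2) $\widetilde A=\alpha\oplus0$, $A=\begin{bmatrix}0&1\\ \tau&0\end{bmatrix}$, $\alpha\in\{0,1\}$, $0\le\tau<1$: $\overline yv$, $\overline xv$, $\overline uy$, $(1+\tau)\mathrm{Re}(\overline xu)+i(1-\tau)\mathrm{Im}(\overline xu)-\frac{\alpha}{c}$. - (C3) $\widetilde A=\begin{bmatrix}\alpha&\beta\\ \beta&\omega\end{bmatrix}$, $A=\begin{bmatrix}0&1\\1&0\end{bmatrix}$, with $\alpha=\omega=0,\beta=1$ or $\beta=0,\alpha\in\{0,1\},\omega\in\{0,\pm\alpha\}$: $2\mathrm{Re}(\overline yv)-(-1)^k\omega$, $2\mathrm{Re}(\overline xu)-(-1)^k\alpha$, $\overline xv+\overline uy-(-1)^k\beta$. - (C4) $\widetilde A=\alpha\oplus0$,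 $A=\begin{bmatrix}0&1\\1&i\end{bmatrix}$, $\alpha\in\{0,1\}$: $\overline xv+\overline uy$, $\overline uv$, $\mathrm{Re}(\overline yv)$, $v^2$, $2\mathrm{Re}(\overline xu)+i|u|^2-\frac{\alpha}{c}$. - (C5) $\widetilde A=A=1\oplus e^{i\theta}$, $0<\theta<\pi$: $u^2$, $y^2$, $|x|^2-1$, $|v|^2-1$. - (C6) $\widetilde A=\begin{bmatrix}\alpha&\beta\\ \beta&\omega\end{bmatrix}$, $A=\begin{bmatrix}0&1\\1&i\end{bmatrix}$, with $\beta=1,\alpha=0,\omega\in\{0,i\}$ or $\beta=0,-\omega=\alpha\in\{0,1\}$: $2\mathrm{Re}(\overline xu)-(-1)^k\alpha$, $2\mathrm{Re}(\overline yv)-(-1)^k\mathrm{Re}(\omega)$, $\overline xv+\overline uy-(-1)^k\beta$, $u^2$, $|v|^2-(-1)^k\mathrm{Im}(\omega)$. - (C7) $\widetilde A=A=\begin{bmatrix}0&1\\ \tau&0\end{bmatrix}$, $0\le\tau<1$: $\overline xu$, $\overline yv$, $\overline yu$, $\overline xv-c^{-1}$; and, if $0<\tau<1$, also $c-(-1)^k$.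 - (C8) $\widetilde A=\alpha\oplus\omega$, $A=1\oplus\sigma$, $\sigma\in\{1,-1\}$, with $\alpha=1,\omega\in\{\sigma,0\}$ or $\alpha=\omega=0$: $|x|^2+\sigma|u|^2-c^{-1}\alpha$, $\overline xy+\sigma\overline uv$, $|y|^2+\sigma|v|^2-c^{-1}\omega$; and, if $\omega=\sigma$, also $c-(-1)^k$, with $k=0$ if $\sigma=1$. - (C9) $\widetilde A=\alpha\oplus0$, $A=1\oplus0$, $\alpha\in\{0,1\}$: $y^2$, $|x|^2-\alpha$; and, if $\alpha=1$ and $\|E\|\le\frac12$, also $c-1$. - (C10) $\widetilde A=\begin{bmatrix}0&1\\1&0\end{bmatrix}$, $A=1\oplus-1$: $\overline xy-\overline uv-(-1)^k$, $|x|^2-|u|^2$, $|y|^2-|v|^2$. Conversely, if $\widetilde A\to A$ are as in one of the lines (C1), (C2), (C3), (C4), then there is a constant $\rho>0$ such that for all $s\in(0,1]$ and all $c,P$ (and $k\in\mathbb Z$): if the moduli of the expressions of the line are at most $s$, where in line (C3) with $\widetilde A\ne0_2$ it is also assumed that $c=(-1)^k$, then $\|E\|\le\rho\sqrt s$. -/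

import Mathlib

open Matrix ComplexConjugate

-- The norm on matrices is the max norm `‖X‖ = max |x_{jk}|` throughout.
attribute [local instance] Matrix.normedAddCommGroup Matrix.normedSpace

namespace StarAction

/-- Complex `2 × 2` matrices. -/
abbrev Mat2 := Matrix (Fin 2) (Fin 2) ℂ

/-- The action `Ψ₁`: `((c, P), A) ↦ c P* A P`, with `c ∈ S¹` and `P ∈ GL₂(ℂ)`. -/
noncomputable def act (c : Circle) (P : GL (Fin 2) ℂ) (A : Mat2) : Mat2 :=
  (c : ℂ) • ((P : Mat2)ᴴ * A * (P : Mat2))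

/-- The orbit of `A`. -/
def orb (A : Mat2) : Set Mat2 := {M | ∃ (c : Circle) (P : GL (Fin 2) ℂ), M = act c P A}

/-- A path `B → A` in the closure graph: the orbit of `B` lies in the closure of the orbit
of `A`. -/
def Path (B A : Mat2) : Prop := orb B ⊆ closure (orb A)

/-- The orbit map of `A`, with the circle factor parametrized by `t ↦ e^{it}` (a local
diffeomorphism `ℝ → S¹`), and `GL₂(ℂ)` seen as an open subset of the space of matrices. -/
noncomputable def orbitMap (A : Mat2) (g : ℝ × Mat2) : Mat2 :=
  (Circle.exp g.1 : ℂ) • (g.2ᴴ * A * g.2)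

/-- The orbit of `A` (an immersed real submanifold) has dimension `d`: the orbit map has
real rank `d` at every element of the group. -/
def HasOrbitDim (A : Mat2) (d : ℕ) : Prop :=
  ∀ (t : ℝ) (P : GL (Fin 2) ℂ),
    Module.finrank ℝ
      (LinearMap.range (fderiv ℝ (orbitMap A) (t, (P : Mat2))).toLinearMap) = d

/-- The vertices of the closure graph. -/
inductive Vertex
  /-- `1 ⊕ e^{iθ}`, `0 < θ < π` -/
  | diagTheta (θ : Set.Ioo (0 : ℝ) Real.pi)
  /-- `[0 1; τ 0]`, `0 < τ < 1` -/
  | antiTau (τ : Set.Ioo (0 : ℝ) 1)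
  /-- `[0 1; 1 i]` -/
  | antiI
  /-- `[0 1; 0 0]` -/
  | nilp
  /-- `1 ⊕ -1` -/
  | diagNeg
  /-- `I₂` -/
  | one
  /-- `1 ⊕ 0` -/
  | rankOne
  /-- `0₂` -/
  | zero

namespace Vertex

/-- The normal form representing a vertex. -/
noncomputable def mat : Vertex → Mat2
  | diagTheta θ => !![1, 0; 0, Complex.exp ((θ : ℝ) * Complex.I)]
  | antiTau τ => !![0, 1; ((τ : ℝ) : ℂ), 0]
  | antiI => !![0, 1; 1, Complex.I]
  | nilp => !![0, 1; 0, 0]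
  | diagNeg => !![1, 0; 0, -1]
  | one => !![1, 0; 0, 1]
  | rankOne => !![1, 0; 0, 0]
  | zero => !![0, 0; 0, 0]

/-- The horizontal level of a vertex. -/
def level : Vertex → ℕ
  | diagTheta _ => 7
  | antiTau _ => 7
  | antiI => 7
  | nilp => 6
  | diagNeg => 5
  | one => 5
  | rankOne => 4
  | zero => 0

/-- The arrows that are drawn in the graph. -/
inductive Arrow : Vertex → Vertex → Prop
  | zero_rankOne : Arrow zero rankOne
  | rankOne_diagNeg : Arrow rankOne diagNeg
  | rankOne_one : Arrow rankOne one
  | rankOne_nilp : Arrow rankOne nilp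
  | rankOne_diagTheta (θ) : Arrow rankOne (diagTheta θ)
  | rankOne_antiTau (τ) : Arrow rankOne (antiTau τ)
  | rankOne_antiI : Arrow rankOne antiI
  | diagNeg_antiI : Arrow diagNeg antiI

end Vertex

/-- The matrix `[0 1; 1 0]`, a second representative of the orbit of `1 ⊕ -1`. -/
def swap : Mat2 := !![0, 1; 1, 0]

/-- The representatives that occur: the normal forms of the graph and `[0 1; 1 0]`. -/
def IsRep (A : Mat2) : Prop := (∃ V : Vertex, A = V.mat) ∨ A = swap

/-- The perturbation `E = c P* A P - B`. -/
noncomputable def pert (B A : Mat2) (c : Circle) (P : GL (Fin 2) ℂ) : Mat2 := act c P A - B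

/-- The standing smallness assumption: if `A` and `B` are both nonsingular, then
`‖E‖ ≤ |det B| / (8 ‖B‖ + 4)`. -/
def Small (B A : Mat2) (c : Circle) (P : GL (Fin 2) ℂ) : Prop :=
  B.det ≠ 0 → A.det ≠ 0 → ‖pert B A c P‖ ≤ ‖B.det‖ / (8 * ‖B‖ + 4)

/-- A finite list of expressions in `c`, the entries `x, y, u, v` of `P = [x y; u v]`, and an
integer `k` (in this order). -/
abbrev Exprs := ℂ → ℂ → ℂ → ℂ → ℂ → ℤ → List ℂ

/-- All expressions of the list have modulus at most `r`. -/
def BoundedBy (F : Exprs) (c : Circle) (P : GL (Fin 2) ℂ) (k : ℤ) (r : ℝ) : Prop :=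
  ∀ z ∈ F c ((P : Mat2) 0 0) ((P : Mat2) 0 1) ((P : Mat2) 1 0) ((P : Mat2) 1 1) k, ‖z‖ ≤ r

/-- Lines of the table for which a converse estimate is claimed: `ConvLine B A free F` lists
`B` (the starting point of the path), `A` (its end point) and the expressions `F`. The flag
`free` tells that `c` is unrestricted in the converse; otherwise the converse is about
`c = (-1)^k`. -/
inductive ConvLine : Mat2 → Mat2 → Prop → Exprs → Prop
  | diagTheta (α : ℂ) (θ : ℝ) (hα : α = 0 ∨ α = 1) (h0 : 0 ≤ θ) (h1 : θ < Real.pi) :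
      ConvLine !![α, 0; 0, 0] !![1, 0; 0, Complex.exp (θ * Complex.I)] True
        (fun c x y u v _ =>
          [(‖x‖ : ℂ) ^ 2 + Complex.exp (θ * Complex.I) * (‖u‖ : ℂ) ^ 2 - c⁻¹ * α, y ^ 2, v ^ 2])
  | antiTau (α : ℂ) (τ : ℝ) (hα : α = 0 ∨ α = 1) (h0 : 0 ≤ τ) (h1 : τ < 1) :
      ConvLine !![α, 0; 0, 0] !![0, 1; (τ : ℂ), 0] True
        (fun c x y u v _ =>
          [conj y * v, conj x * v, conj u * y,
            (1 + τ) * ((conj x * u).re : ℂ) + Complex.I * (1 - τ) * ((conj x * u).im : ℂ)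
              - α / c])
  | swap (α β ω : ℂ)
      (h : (α = 0 ∧ ω = 0 ∧ β = 1) ∨
        (β = 0 ∧ (α = 0 ∨ α = 1) ∧ (ω = 0 ∨ ω = α ∨ ω = -α))) :
      ConvLine !![α, β; β, ω] swap (!![α, β; β, ω] = (0 : Mat2))
        (fun _ x y u v k =>
          [2 * ((conj y * v).re : ℂ) - (-1) ^ k * ω, 2 * ((conj x * u).re : ℂ) - (-1) ^ k * α,
            (conj x * v + conj u * y) - (-1) ^ k * β])
  | antiI (α : ℂ) (hα : α = 0 ∨ α = 1) :
      ConvLine !![α, 0; 0, 0] !![0, 1; 1, Complex.I] True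
        (fun c x y u v _ =>
          [conj x * v + conj u * y, conj u * v, ((conj y * v).re : ℂ), v ^ 2,
            2 * ((conj x * u).re : ℂ) + Complex.I * (‖u‖ : ℂ) ^ 2 - α / c])

/-- All lines of the table: `Line B A F`. The sub-line of the pair
`α ⊕ 0`, `1 ⊕ 0` with its own bound on `‖E‖` is stated separately in the theorem. -/
inductive Line : Mat2 → Mat2 → Exprs → Prop
  | ofConv {B A : Mat2} {free : Prop} {F : Exprs} (h : ConvLine B A free F) : Line B A F
  | diagTheta_self (θ : ℝ) (h0 : 0 < θ) (h1 : θ < Real.pi) :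
      Line !![1, 0; 0, Complex.exp (θ * Complex.I)] !![1, 0; 0, Complex.exp (θ * Complex.I)]
        (fun _ x y u v _ => [u ^ 2, y ^ 2, (‖x‖ : ℂ) ^ 2 - 1, (‖v‖ : ℂ) ^ 2 - 1])
  | antiI_sym (α β ω : ℂ)
      (h : (β = 1 ∧ α = 0 ∧ (ω = 0 ∨ ω = Complex.I)) ∨
        (β = 0 ∧ -ω = α ∧ (α = 0 ∨ α = 1))) :
      Line !![α, β; β, ω] !![0, 1; 1, Complex.I]
        (fun _ x y u v k =>
          [2 * ((conj x * u).re : ℂ) - (-1) ^ k * α,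
            2 * ((conj y * v).re : ℂ) - (-1) ^ k * (ω.re : ℂ),
            conj x * v + conj u * y - (-1) ^ k * β, u ^ 2,
            (‖v‖ : ℂ) ^ 2 - (-1) ^ k * (ω.im : ℂ)])
  | antiTau_self (τ : ℝ) (h0 : 0 ≤ τ) (h1 : τ < 1) :
      Line !![0, 1; (τ : ℂ), 0] !![0, 1; (τ : ℂ), 0]
        (fun c x y u v _ => [conj x * u, conj y * v, conj y * u, conj x * v - c⁻¹])
  | antiTau_self_c (τ : ℝ) (h0 : 0 < τ) (h1 : τ < 1) :
      Line !![0, 1; (τ : ℂ), 0] !![0, 1; (τ : ℂ), 0] (fun c _ _ _ _ k => [c - (-1) ^ k])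
  | diagSign (α ω σ : ℂ) (hσ : σ = 1 ∨ σ = -1)
      (h : (α = 1 ∧ (ω = σ ∨ ω = 0)) ∨ (α = 0 ∧ ω = 0)) :
      Line !![α, 0; 0, ω] !![1, 0; 0, σ]
        (fun c x y u v _ =>
          [((‖x‖ : ℂ) ^ 2 + σ * (‖u‖ : ℂ) ^ 2) - c⁻¹ * α, conj x * y + σ * (conj u * v),
            ((‖y‖ : ℂ) ^ 2 + σ * (‖v‖ : ℂ) ^ 2) - c⁻¹ * ω])
  | diagOne_self_c : Line !![1, 0; 0, 1] !![1, 0; 0, 1] (fun c _ _ _ _ _ => [c - 1])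
  | diagNeg_self_c :
      Line !![1, 0; 0, -1] !![1, 0; 0, -1] (fun c _ _ _ _ k => [c - (-1) ^ k])
  | rankOne (α : ℂ) (hα : α = 0 ∨ α = 1) :
      Line !![α, 0; 0, 0] !![1, 0; 0, 0] (fun _ x y _ _ _ => [y ^ 2, (‖x‖ : ℂ) ^ 2 - α])
  | swap_diagNeg :
      Line swap !![1, 0; 0, -1]
        (fun _ x y u v k =>
          [conj x * y - conj u * v - (-1) ^ k, (‖x‖ : ℂ) ^ 2 - (‖u‖ : ℂ) ^ 2,
            (‖y‖ : ℂ) ^ 2 - (‖v‖ : ℂ) ^ 2])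

end StarAction

namespace StarAction

/-! ### The action and its orbits -/

/-! Closure graph. Under the action `cotrace M` and `‖M.det‖` are both multiplied by `‖P.det‖ ^ 2`,
so a path `B → A` forces `cotrace B * ‖A.det‖ = cotrace A * ‖B.det‖`, a closed condition. On
nonsingular normal forms the quotient of the two is `2 cos θ`, `-(τ + 1/τ)`, `2` or `-2`, and only
`1 ⊕ -1` and `[0 1; 1 i]` share a value. A path from the latter to the former is excluded because
limits of unimodular multiples of Hermitian matrices satisfy a sign condition
(`Path.re_nonneg_of_isHermitian`). Vanishing of the determinant and of the cotrace settles the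
singular forms. The arrows themselves come from explicit degenerating curves in the group.
Uniqueness of the normal form follows, since levels strictly increase along arrows; existence comes
from finding an isotropic vector or diagonalizing (`exists_vertex`).

Dimensions. By equivariance the rank of the orbit map is that of `infAct A`
(`finrank_range_fderiv`), whose range is cut out by explicit independent real equations.

Estimates. Without a path, `B` has positive distance from the orbit of `A`. With one, `‖E‖` bounds
each entry of `P* A P - c⁻¹ B`, and the listed expressions are extracted by taking real and
imaginary parts or combining conjugate entries. Where signs occur, `c` is shown to be near `±1`: by
reality of an entry, by conjugate entries, or by comparing determinants (`mul_abs_im_le`). The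
converses reassemble the entries from the expressions. -/

lemma act_mul (c d : Circle) (P Q : GL (Fin 2) ℂ) (A : Mat2) :
    act c P (act d Q A) = act (c * d) (Q * P) A := by
  simp only [act, Circle.coe_mul, Units.val_mul, conjTranspose_mul, Matrix.mul_smul,
    Matrix.smul_mul, smul_smul, Matrix.mul_assoc]

lemma act_one (A : Mat2) : act 1 1 A = A := by simp [act]

lemma mem_orb_self (A : Mat2) : A ∈ orb A := ⟨1, 1, (act_one A).symm⟩

lemma act_mem_orb (c : Circle) (P : GL (Fin 2) ℂ) (A : Mat2) : act c P A ∈ orb A := ⟨c, P, rfl⟩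

lemma mem_orb_trans {A B C : Mat2} (h : A ∈ orb B) (h' : B ∈ orb C) : A ∈ orb C := by
  obtain ⟨c, P, rfl⟩ := h
  obtain ⟨d, Q, rfl⟩ := h'
  exact ⟨c * d, Q * P, act_mul ..⟩

lemma mem_orb_symm {A B : Mat2} (h : A ∈ orb B) : B ∈ orb A := by
  obtain ⟨c, P, rfl⟩ := h
  exact ⟨c⁻¹, P⁻¹, by rw [act_mul]; simp [act_one]⟩

lemma continuous_act (c : Circle) (P : GL (Fin 2) ℂ) : Continuous (act c P) := by
  unfold act
  fun_prop

/-- Each group element acts continuously and preserves the orbit of `A`, so the closure of this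
orbit is invariant and one point of the orbit of `B` decides. -/
lemma path_iff {A B : Mat2} : Path B A ↔ B ∈ closure (orb A) := by
  refine ⟨fun h => h (mem_orb_self B), fun h => ?_⟩
  rintro _ ⟨c, P, rfl⟩
  refine map_mem_closure (continuous_act c P) h ?_
  intro M hM
  exact mem_orb_trans (act_mem_orb c P M) hM

lemma Path.trans {A B C : Mat2} (h : Path A B) (h' : Path B C) : Path A C :=
  Set.Subset.trans h (closure_minimal h' isClosed_closure)

lemma path_of_mem_orb {A B : Mat2} (h : B ∈ orb A) : Path B A :=
  path_iff.2 (subset_closure h)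

lemma exists_lower_bound {A B : Mat2} (h : ¬ Path B A) :
    ∃ μ : ℝ, 0 < μ ∧ ∀ (c : Circle) (P : GL (Fin 2) ℂ), μ ≤ ‖pert B A c P‖ := by
  replace h : ¬ ∀ ε > 0, ∃ M ∈ orb A, dist B M < ε :=
    fun h' => h (path_iff.2 (Metric.mem_closure_iff.2 h'))
  push Not at h
  obtain ⟨μ, hμ, h⟩ := h
  refine ⟨μ, hμ, fun c P => ?_⟩
  have := h _ (act_mem_orb c P A)
  rwa [dist_comm, dist_eq_norm] at this

lemma act_fin_two (c : Circle) (P : GL (Fin 2) ℂ) (a b g d : ℂ) {x y u v : ℂ}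
    (hx : (P : Mat2) 0 0 = x) (hy : (P : Mat2) 0 1 = y) (hu : (P : Mat2) 1 0 = u)
    (hv : (P : Mat2) 1 1 = v) :
    act c P !![a, b; g, d] =
      !![c * (conj x * (a * x + b * u) + conj u * (g * x + d * u)),
          c * (conj x * (a * y + b * v) + conj u * (g * y + d * v));
        c * (conj y * (a * x + b * u) + conj v * (g * x + d * u)),
          c * (conj y * (a * y + b * v) + conj v * (g * y + d * v))] := by
  subst hx hy hu hv
  ext i j
  fin_cases i <;> fin_cases j <;>
    simp [act, Matrix.mul_apply, Fin.sum_univ_two, conjTranspose_apply] <;> ring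

/-- Membership in an orbit, from an explicit matrix of nonzero determinant. -/
lemma mem_orb_of_entries {a b g d : ℂ} {M : Mat2} (c x y u v : ℂ) (hc : ‖c‖ = 1)
    (hP : x * v - y * u ≠ 0)
    (h00 : M 0 0 = c * (conj x * (a * x + b * u) + conj u * (g * x + d * u)))
    (h01 : M 0 1 = c * (conj x * (a * y + b * v) + conj u * (g * y + d * v)))
    (h10 : M 1 0 = c * (conj y * (a * x + b * u) + conj v * (g * x + d * u)))
    (h11 : M 1 1 = c * (conj y * (a * y + b * v) + conj v * (g * y + d * v))) :
    M ∈ orb !![a, b; g, d] := by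
  have hdet : (!![x, y; u, v] : Mat2).det ≠ 0 := by rwa [det_fin_two_of]
  obtain ⟨c, rfl⟩ : ∃ c' : Circle, (c' : ℂ) = c := ⟨⟨c, mem_sphere_zero_iff_norm.2 hc⟩, rfl⟩
  refine ⟨c, GeneralLinearGroup.mkOfDetNeZero _ hdet, ?_⟩
  rw [act_fin_two (x := x) (y := y) (u := u) (v := v) _ _ _ _ _ _ rfl rfl rfl rfl]
  ext i j
  fin_cases i <;> fin_cases j <;> simp_all

/-! ### Invariants of the action -/

/-- The real number `tr (adj(M*) M)`. -/
noncomputable def cotrace (M : Mat2) : ℝ :=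
  2 * (conj (M 0 0) * M 1 1).re - ‖M 0 1‖ ^ 2 - ‖M 1 0‖ ^ 2

lemma cotrace_eq (M : Mat2) :
    (cotrace M : ℂ) = conj (M 0 0) * M 1 1 + M 0 0 * conj (M 1 1)
      - M 0 1 * conj (M 0 1) - M 1 0 * conj (M 1 0) := by
  apply Complex.ext <;>
    simp [cotrace, Complex.sq_norm, Complex.normSq_apply] <;> ring

lemma circle_mul_conj (c : Circle) : (c : ℂ) * conj (c : ℂ) = 1 := by
  simp [Complex.mul_conj]

/-- Conceptually, `adj(M*) M` becomes `conj (det P) • adj(P) adj(A*) A P`: the circle factor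
cancels, and cyclicity of the trace supplies the other factor `det P`. -/
lemma cotrace_act (c : Circle) (P : GL (Fin 2) ℂ) (A : Mat2) :
    cotrace (act c P A) = ‖(P : Mat2).det‖ ^ 2 * cotrace A := by
  have key : (cotrace (act c P A) : ℂ) =
      ((‖(P : Mat2).det‖ : ℂ) ^ 2) * (cotrace A : ℂ) := by
    have hA : act c P A = act c P !![A 0 0, A 0 1; A 1 0, A 1 1] := by rw [← eta_fin_two A]
    rw [hA, act_fin_two c P _ _ _ _ rfl rfl rfl rfl, ← Complex.mul_conj', cotrace_eq, cotrace_eq,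
      det_fin_two]
    simp only [of_apply, cons_val', cons_val_zero, cons_val_one, cons_val_fin_one, map_mul,
      map_add, map_sub, Complex.conj_conj]
    generalize (P : Mat2) 0 0 = x, (P : Mat2) 0 1 = y, (P : Mat2) 1 0 = u, (P : Mat2) 1 1 = v,
      A 0 0 = a, A 0 1 = b, A 1 0 = g, A 1 1 = d
    linear_combination (circle_mul_conj c) * ((x * v - y * u) * (conj x * conj v - conj y * conj u)) *
      (conj a * d + a * conj d - b * conj b - g * conj g)
  exact_mod_cast key

lemma det_act (c : Circle) (P : GL (Fin 2) ℂ) (A : Mat2) :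
    (act c P A).det = (c : ℂ) ^ 2 * (‖(P : Mat2).det‖ : ℂ) ^ 2 * A.det := by
  rw [← Complex.mul_conj', act, det_smul, det_mul, det_mul, det_conjTranspose]
  simp
  ring

lemma norm_det_act (c : Circle) (P : GL (Fin 2) ℂ) (A : Mat2) :
    ‖(act c P A).det‖ = ‖(P : Mat2).det‖ ^ 2 * ‖A.det‖ := by
  rw [det_act, norm_mul, norm_mul, norm_pow, norm_pow, Circle.norm_coe, Complex.norm_real, norm_norm]
  ring

lemma continuous_cotrace : Continuous cotrace := by
  unfold cotrace
  fun_prop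

lemma Path.cotrace_mul {B A : Mat2} (h : Path B A) :
    cotrace B * ‖A.det‖ = cotrace A * ‖B.det‖ := by
  have hcl : IsClosed {M : Mat2 | cotrace M * ‖A.det‖ = cotrace A * ‖M.det‖} :=
    isClosed_eq (continuous_cotrace.mul continuous_const)
      (continuous_const.mul (continuous_id.matrix_det.norm))
  refine closure_minimal ?_ hcl (path_iff.1 h)
  rintro _ ⟨c, P, rfl⟩
  simp only [Set.mem_ofPred_eq, cotrace_act, norm_det_act]
  ring

lemma Path.det_eq_zero {B A : Mat2} (h : Path B A) (hA : A.det = 0) : B.det = 0 := by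
  have hcl : IsClosed {M : Mat2 | M.det = 0} := isClosed_eq continuous_id.matrix_det continuous_const
  refine closure_minimal ?_ hcl (path_iff.1 h)
  rintro _ ⟨c, P, rfl⟩
  simp [det_act, hA]

lemma Path.cotrace_eq_zero {B A : Mat2} (h : Path B A) (hA : cotrace A = 0) : cotrace B = 0 := by
  have hcl : IsClosed {M : Mat2 | cotrace M = 0} := isClosed_eq continuous_cotrace continuous_const
  refine closure_minimal ?_ hcl (path_iff.1 h)
  rintro _ ⟨c, P, rfl⟩
  simp [cotrace_act, hA]

lemma Path.eq_zero {B : Mat2} (h : Path B 0) : B = 0 := by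
  have hcl : IsClosed {(0 : Mat2)} := isClosed_singleton
  refine closure_minimal ?_ hcl (path_iff.1 h)
  rintro _ ⟨c, P, rfl⟩
  simp [act]

/-- Unimodular multiples of Hermitian matrices form a set whose closure omits `[0 1; 1 i]`. -/
lemma Path.re_nonneg_of_isHermitian {B A : Mat2} (h : Path B A) (hA : A.IsHermitian) :
    0 ≤ (B 0 1 * B 1 0 * conj (B 1 1) ^ 2).re := by
  have hcl : IsClosed {M : Mat2 | 0 ≤ (M 0 1 * M 1 0 * conj (M 1 1) ^ 2).re} := by
    refine isClosed_le continuous_const ?_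
    fun_prop
  refine closure_minimal ?_ hcl (path_iff.1 h)
  rintro _ ⟨c, P, rfl⟩
  set H : Mat2 := (P : Mat2)ᴴ * A * (P : Mat2) with hH
  have hherm : H.IsHermitian := isHermitian_conjTranspose_mul_mul _ hA
  have h10 : H 1 0 = conj (H 0 1) := (hherm.apply 1 0).symm
  have h11 : conj (H 1 1) = H 1 1 := hherm.apply 1 1
  have hre : H 1 1 = ((H 1 1).re : ℂ) := (Complex.conj_eq_iff_re.1 h11).symm
  -- Two factors `c` meet two factors `conj c`, so the monomial only sees the Hermitian matrix `H`,
  -- where it is a product of squares.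
  have : act c P A 0 1 * act c P A 1 0 * conj (act c P A 1 1) ^ 2 =
      ((‖H 0 1‖ ^ 2 * (H 1 1).re ^ 2 : ℝ) : ℂ) := by
    have e : act c P A = (c : ℂ) • H := rfl
    simp only [e, Matrix.smul_apply, smul_eq_mul, map_mul, h10, h11]
    push_cast
    rw [← hre, ← Complex.mul_conj']
    linear_combination ((c : ℂ) * conj (c : ℂ) + 1) * H 0 1 * conj (H 0 1) * H 1 1 ^ 2 *
      circle_mul_conj c
  simp only [Set.mem_ofPred_eq, this, Complex.ofReal_re]
  positivity

/-! ### The closure graph -/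

open Vertex

/-! ### Degenerating curves that realize the arrows. -/

lemma path_zero (A : Mat2) : Path Vertex.zero.mat A := by
  rw [path_iff]
  have hz : Vertex.zero.mat = 0 := by ext i j; fin_cases i <;> fin_cases j <;> rfl
  rw [hz]
  -- The scalar matrix `t` acts as multiplication by `t ^ 2`.
  have hlim : Filter.Tendsto (fun t : ℝ => ((t : ℂ) ^ 2) • A) (nhdsWithin 0 {0}ᶜ) (nhds 0) := by
    have : Continuous (fun t : ℝ => ((t : ℂ) ^ 2) • A) := by fun_prop
    simpa using (this.tendsto 0).mono_left nhdsWithin_le_nhds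
  refine mem_closure_of_tendsto hlim ?_
  filter_upwards [self_mem_nhdsWithin] with t ht
  have ht' : (t : ℂ) ≠ 0 := by simpa using ht
  rw [eta_fin_two A]
  refine mem_orb_of_entries 1 t 0 0 t (by simp) (by simpa using ht') ?_ ?_ ?_ ?_ <;>
    simp <;> ring

/-- A curve `P(ε)` degenerating to a rank one matrix exhibits `1 ⊕ 0` in the closure. -/
lemma path_rankOne {a b g d : ℂ} (c x y u v : ℂ) (hc : ‖c‖ = 1) (hP : x * v - y * u ≠ 0)
    (h : c * (conj x * (a * x + b * u) + conj u * (g * x + d * u)) = 1) :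
    Path rankOne.mat !![a, b; g, d] := by
  rw [path_iff]
  -- The second column of `P` is multiplied by `t`; at `t = 0` only the entry `1` survives.
  let M : ℝ → Mat2 := fun t =>
    !![1, t * (c * (conj x * (a * y + b * v) + conj u * (g * y + d * v)));
      t * (c * (conj y * (a * x + b * u) + conj v * (g * x + d * u))),
      (t : ℂ) ^ 2 * (c * (conj y * (a * y + b * v) + conj v * (g * y + d * v)))]
  have hM : Continuous M := by
    refine continuous_matrix fun i j => ?_
    fin_cases i <;> fin_cases j <;> simp [M] <;> fun_prop
  have h0 : M 0 = rankOne.mat := by simp [M, Vertex.mat]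
  have hlim : Filter.Tendsto M (nhdsWithin 0 {0}ᶜ) (nhds rankOne.mat) := by
    rw [← h0]
    exact (hM.tendsto 0).mono_left nhdsWithin_le_nhds
  refine mem_closure_of_tendsto hlim ?_
  filter_upwards [self_mem_nhdsWithin] with t ht
  have ht' : (t : ℂ) ≠ 0 := by simpa using ht
  refine mem_orb_of_entries c x (t * y) u (t * v) hc ?_ ?_ ?_ ?_ ?_
  · have : x * (t * v) - t * y * u = t * (x * v - y * u) := by ring
    rw [this]
    exact mul_ne_zero ht' hP
  · simp [M, h]
  all_goals
    simp [M]
    ring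

lemma path_rankOne_diag (d : ℂ) : Path rankOne.mat !![1, 0; 0, d] :=
  path_rankOne 1 1 0 0 1 (by simp) (by simp) (by simp)

lemma path_rankOne_anti {τ : ℝ} (h : 0 ≤ τ) : Path rankOne.mat !![0, 1; (τ : ℂ), 0] := by
  have h1 : (0 : ℝ) < 1 + τ := by linarith
  have h2 : ((√(1 + τ) : ℝ) : ℂ) ^ 2 = 1 + τ := by
    rw [← Complex.ofReal_pow, Real.sq_sqrt h1.le]; simp
  have h3 : ((√(1 + τ) : ℝ) : ℂ) ≠ 0 := by
    simpa using (Real.sqrt_pos.2 h1).ne'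
  -- The form takes the value `1 + τ` at the vector `(1, 1)`, whence the normalization.
  refine path_rankOne 1 (1 / (√(1 + τ) : ℝ)) 0 (1 / (√(1 + τ) : ℝ)) 1 (by simp) (by simpa using h3) ?_
  simp
  field_simp
  exact h2.symm

lemma path_rankOne_antiI : Path rankOne.mat !![0, 1; 1, Complex.I] :=
  path_rankOne (-Complex.I) 0 1 1 0 (by simp) (by simp) (by simp)

/-- The columns of `P` are the isotropic vectors `(1, ±1) / √2` of `1 ⊕ -1`. -/
lemma swap_mem_orb : swap ∈ orb diagNeg.mat := by
  have h2 : ((√2 : ℝ) : ℂ) ^ 2 = 2 := by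
    rw [← Complex.ofReal_pow, Real.sq_sqrt (by norm_num)]; simp
  have h3 : ((√2 : ℝ) : ℂ) ≠ 0 := by simp
  have h4 : ((√2 : ℝ) : ℂ)⁻¹ * ((√2 : ℝ) : ℂ)⁻¹ = 1 / 2 := by
    rw [← mul_inv, ← sq, h2]; norm_num
  have h5 : (1 / ((√2 : ℝ) : ℂ)) * (-1 / ((√2 : ℝ) : ℂ)) - 1 / ((√2 : ℝ) : ℂ) * (1 / ((√2 : ℝ) : ℂ)) ≠ 0 := by
    field_simp
    rw [h2]; norm_num
  refine mem_orb_of_entries 1 (1 / (√2 : ℝ)) (1 / (√2 : ℝ)) (1 / (√2 : ℝ)) (-1 / (√2 : ℝ)) (by simp)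
    h5 ?_ ?_ ?_ ?_ <;>
    simp [swap, neg_div] <;> rw [h4] <;> norm_num

/-- The matrix `t⁻¹ ⊕ t` fixes the antidiagonal and shrinks the entry `i` to `t ^ 2 i`. -/
lemma path_swap_antiI : Path swap antiI.mat := by
  rw [path_iff]
  let M : ℝ → Mat2 := fun t => !![0, 1; 1, t ^ 2 * Complex.I]
  have hM : Continuous M := by
    refine continuous_matrix fun i j => ?_
    fin_cases i <;> fin_cases j <;> simp [M] <;> fun_prop
  have h0 : M 0 = swap := by simp [M, swap]
  have hlim : Filter.Tendsto M (nhdsWithin 0 {0}ᶜ) (nhds swap) := by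
    rw [← h0]
    exact (hM.tendsto 0).mono_left nhdsWithin_le_nhds
  refine mem_closure_of_tendsto hlim ?_
  filter_upwards [self_mem_nhdsWithin] with t ht
  have ht' : (t : ℂ) ≠ 0 := by simpa using ht
  refine mem_orb_of_entries 1 (t : ℂ)⁻¹ 0 0 t (by simp) (by simp [ht']) ?_ ?_ ?_ ?_ <;>
    simp [M, ht']
  ring

lemma Vertex.Arrow.path {V W : Vertex} (h : Arrow V W) : Path V.mat W.mat := by
  cases h with
  | zero_rankOne => exact path_zero _
  | rankOne_diagNeg => exact path_rankOne_diag _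
  | rankOne_one => exact path_rankOne_diag _
  | rankOne_nilp => simpa [Vertex.mat] using path_rankOne_anti le_rfl
  | rankOne_diagTheta θ => exact path_rankOne_diag _
  | rankOne_antiTau τ => exact path_rankOne_anti τ.2.1.le
  | rankOne_antiI => exact path_rankOne_antiI
  | diagNeg_antiI => exact (path_of_mem_orb (mem_orb_symm swap_mem_orb)).trans path_swap_antiI

lemma path_of_reflTransGen {V W : Vertex} (h : Relation.ReflTransGen Arrow V W) :
    Path V.mat W.mat := by
  induction h with
  | refl => exact Set.Subset.trans subset_closure subset_rfl
  | tail _ h ih => exact ih.trans h.path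

/-! ### Separating the normal forms by cotrace and determinant. -/

namespace Vertex

lemma det_diagTheta (θ) : (diagTheta θ).mat.det = Complex.exp ((θ : ℝ) * Complex.I) := by
  simp [Vertex.mat]
lemma det_antiTau (τ) : (antiTau τ).mat.det = -((τ : ℝ) : ℂ) := by simp [Vertex.mat]
lemma det_antiI : antiI.mat.det = -1 := by simp [Vertex.mat]
lemma det_nilp : nilp.mat.det = 0 := by simp [Vertex.mat]
lemma det_diagNeg : diagNeg.mat.det = -1 := by simp [Vertex.mat]
lemma det_one : one.mat.det = 1 := by simp [Vertex.mat]
lemma det_rankOne : rankOne.mat.det = 0 := by simp [Vertex.mat]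
lemma det_zero : zero.mat.det = 0 := by simp [Vertex.mat]

lemma cotrace_diagTheta (θ) : cotrace (diagTheta θ).mat = 2 * Real.cos θ := by
  simp [Vertex.mat, cotrace, Complex.exp_ofReal_mul_I_re]
lemma cotrace_antiTau (τ) : cotrace (antiTau τ).mat = -1 - (τ : ℝ) ^ 2 := by
  simp [Vertex.mat, cotrace]
lemma cotrace_antiI : cotrace antiI.mat = -2 := by
  simp [Vertex.mat, cotrace]; norm_num
lemma cotrace_nilp : cotrace nilp.mat = -1 := by simp [Vertex.mat, cotrace]
lemma cotrace_diagNeg : cotrace diagNeg.mat = -2 := by simp [Vertex.mat, cotrace]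
lemma cotrace_one : cotrace one.mat = 2 := by simp [Vertex.mat, cotrace]
lemma cotrace_rankOne : cotrace rankOne.mat = 0 := by simp [Vertex.mat, cotrace]

end Vertex

lemma not_path_antiI_diagNeg : ¬ Path antiI.mat diagNeg.mat := by
  intro h
  have hA : diagNeg.mat.IsHermitian := by
    ext i j
    fin_cases i <;> fin_cases j <;> simp [Vertex.mat]
  have := h.re_nonneg_of_isHermitian hA
  norm_num [Vertex.mat] at this

lemma Vertex.eq_zero_of_path {V : Vertex} (h : Path V.mat Vertex.zero.mat) : V = zero := by
  have hz : Vertex.zero.mat = 0 := by ext i j; fin_cases i <;> fin_cases j <;> rfl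
  rw [hz] at h
  have h01 : V.mat 0 1 = 0 := by rw [h.eq_zero]; rfl
  have h00 : V.mat 0 0 = 0 := by rw [h.eq_zero]; rfl
  cases V <;> simp [Vertex.mat] at h00 h01 ⊢

lemma Vertex.det_eq_zero_iff {V : Vertex} :
    V.mat.det = 0 ↔ V = nilp ∨ V = rankOne ∨ V = zero := by
  rcases V with θ | τ | _ | _ | _ | _ | _ | _
  · simp [det_diagTheta]
  · simp [det_antiTau, τ.2.1.ne']
  all_goals
    simp [det_antiI, det_nilp, det_diagNeg, det_one, det_rankOne, det_zero]

/-- The quotient `tr (adj(M*) M) / |det M|` at a nonsingular normal form `M`. -/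
noncomputable def Vertex.ratio : Vertex → ℝ
  | diagTheta θ => 2 * Real.cos θ
  | antiTau τ => (-1 - (τ : ℝ) ^ 2) / τ
  | antiI => -2
  | diagNeg => -2
  | one => 2
  | _ => 0

lemma Vertex.cotrace_eq_ratio_mul {V : Vertex} (h : V.mat.det ≠ 0) :
    cotrace V.mat = V.ratio * ‖V.mat.det‖ := by
  rcases V with θ | τ | _ | _ | _ | _ | _ | _
  · simp [det_diagTheta, cotrace_diagTheta, ratio, Complex.norm_exp_ofReal_mul_I]
  · have := τ.2.1.ne'
    simp only [det_antiTau, cotrace_antiTau, ratio, norm_neg, Complex.norm_real, Real.norm_eq_abs,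
      abs_of_pos τ.2.1]
    field_simp
  · simp [det_antiI, cotrace_antiI, ratio]
  · exact absurd det_nilp h
  · simp [det_diagNeg, cotrace_diagNeg, ratio]
  · simp [det_one, cotrace_one, ratio]
  · exact absurd det_rankOne h
  · exact absurd det_zero h

lemma Vertex.ratio_diagTheta_mem (θ) : (diagTheta θ).ratio ∈ Set.Ioo (-2 : ℝ) 2 := by
  have h1 : -1 < Real.cos θ := by
    rw [← Real.cos_pi]; exact Real.cos_lt_cos_of_nonneg_of_le_pi θ.2.1.le le_rfl θ.2.2
  have h2 : Real.cos θ < 1 := by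
    rw [← Real.cos_zero]; exact Real.cos_lt_cos_of_nonneg_of_le_pi le_rfl θ.2.2.le θ.2.1
  constructor <;> simp only [ratio] <;> linarith

lemma Vertex.ratio_antiTau_lt (τ) : (antiTau τ).ratio < -2 := by
  simp only [ratio]
  rw [div_lt_iff₀ τ.2.1]
  nlinarith [pow_pos (sub_pos.2 τ.2.2) 2]

/-- The ratio is injective in `θ` with values in `(-2, 2)` and injective in `τ` with values below
`-2`; the remaining values are `2` for `I₂` and `-2` for the two exceptional forms. -/
lemma Vertex.eq_of_ratio_eq {V W : Vertex} (hV : V.mat.det ≠ 0) (hW : W.mat.det ≠ 0)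
    (h : V.ratio = W.ratio) : V = W ∨ (V = antiI ∧ W = diagNeg) ∨ (V = diagNeg ∧ W = antiI) := by
  have hJ : antiI.ratio = -2 := rfl
  have hN : diagNeg.ratio = -2 := rfl
  have h1 : one.ratio = 2 := rfl
  rcases V with θ | τ | _ | _ | _ | _ | _ | _
  case nilp => exact absurd det_nilp hV
  case rankOne => exact absurd det_rankOne hV
  case zero => exact absurd det_zero hV
  all_goals
    rcases W with θ' | τ' | _ | _ | _ | _ | _ | _
    case nilp => exact absurd det_nilp hW
    case rankOne => exact absurd det_rankOne hW
    case zero => exact absurd det_zero hW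
    case' diagTheta => have hW' := ratio_diagTheta_mem θ'
    case' antiTau => have hW' := ratio_antiTau_lt τ'
  case diagTheta.diagTheta =>
    left
    have : Real.cos θ = Real.cos θ' := by simp only [ratio] at h; linarith
    exact congrArg _ (Subtype.ext (Real.injOn_cos ⟨θ.2.1.le, θ.2.2.le⟩ ⟨θ'.2.1.le, θ'.2.2.le⟩ this))
  case antiTau.antiTau =>
    left
    have h0 := τ.2.1
    have h0' := τ'.2.1
    have : ((τ : ℝ) - τ') * (1 - τ * τ') = 0 := by
      simp only [ratio] at h
      rw [div_eq_div_iff h0.ne' h0'.ne'] at h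
      linear_combination h
    have h2 : (1 - (τ : ℝ) * τ') ≠ 0 := by nlinarith [τ.2.2, τ'.2.2]
    exact congrArg _ (Subtype.ext (sub_eq_zero.1 ((mul_eq_zero.1 this).resolve_right h2)))
  case antiI.antiI | diagNeg.diagNeg | one.one => exact .inl rfl
  case antiI.diagNeg => exact .inr (.inl ⟨rfl, rfl⟩)
  case diagNeg.antiI => exact .inr (.inr ⟨rfl, rfl⟩)
  case diagTheta.antiTau | diagTheta.antiI | diagTheta.diagNeg | diagTheta.one =>
    have hV' := ratio_diagTheta_mem θ
    grind
  case antiTau.diagTheta | antiTau.antiI | antiTau.diagNeg | antiTau.one =>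
    have hV' := ratio_antiTau_lt τ
    grind
  all_goals grind

lemma reflTransGen_of_path {V W : Vertex} (h : Path V.mat W.mat) :
    Relation.ReflTransGen Arrow V W := by
  rcases eq_or_ne W zero with rfl | hW
  · rw [eq_zero_of_path h]
  have hRW : Relation.ReflTransGen Arrow rankOne W := by
    rcases W with θ | τ | _ | _ | _ | _ | _ | _
    exacts [.single (.rankOne_diagTheta θ), .single (.rankOne_antiTau τ), .single .rankOne_antiI,
      .single .rankOne_nilp, .single .rankOne_diagNeg, .single .rankOne_one, .refl, absurd rfl hW]
  rcases eq_or_ne V rankOne with rfl | hVR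
  · exact hRW
  rcases eq_or_ne V zero with rfl | hVz
  · exact .head .zero_rankOne hRW
  have h1 := h.cotrace_mul
  by_cases hdW : W.mat.det = 0
  · have hV : V = nilp := by
      simpa [hVR, hVz] using det_eq_zero_iff.1 (h.det_eq_zero hdW)
    have hW' : W = nilp ∨ W = rankOne := by simpa [hW] using det_eq_zero_iff.1 hdW
    subst hV
    rcases hW' with rfl | rfl
    · exact .refl
    · exact absurd (h.cotrace_eq_zero cotrace_rankOne) (by rw [cotrace_nilp]; norm_num)
  · have hdV : V.mat.det ≠ 0 := by
      intro hdV
      have hV : V = nilp := by simpa [hVR, hVz] using det_eq_zero_iff.1 hdV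
      subst hV
      -- The proportion now reads `-‖W.mat.det‖ = 0`.
      rw [cotrace_nilp, det_nilp, norm_zero, mul_zero] at h1
      exact hdW (by simpa using h1)
    rw [cotrace_eq_ratio_mul hdV, cotrace_eq_ratio_mul hdW] at h1
    have hr : V.ratio = W.ratio :=
      mul_right_cancel₀ (mul_ne_zero (norm_ne_zero_iff.2 hdV) (norm_ne_zero_iff.2 hdW))
        (by linear_combination h1)
    rcases eq_of_ratio_eq hdV hdW hr with rfl | ⟨rfl, rfl⟩ | ⟨rfl, rfl⟩
    · exact .refl
    · exact absurd h not_path_antiI_diagNeg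
    · exact .single .diagNeg_antiI

lemma path_iff_reflTransGen (V W : Vertex) :
    Path V.mat W.mat ↔ Relation.ReflTransGen Arrow V W :=
  ⟨reflTransGen_of_path, path_of_reflTransGen⟩

lemma Vertex.Arrow.level_lt {V W : Vertex} (h : Arrow V W) : V.level < W.level := by
  cases h <;> simp [level]

lemma level_le_of_reflTransGen {V W : Vertex} (h : Relation.ReflTransGen Arrow V W) :
    V = W ∨ V.level < W.level := by
  induction h with
  | refl => exact .inl rfl
  | tail _ h ih =>
    have := h.level_lt
    rcases ih with rfl | ih
    · exact .inr this
    · exact .inr (ih.trans this)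

/-- Two normal forms in one orbit are joined by paths in both directions, while the level strictly
increases along nontrivial paths. -/
lemma vertex_unique {M : Mat2} {V W : Vertex} (hV : M ∈ orb V.mat) (hW : M ∈ orb W.mat) :
    V = W := by
  have h1 := level_le_of_reflTransGen
    (reflTransGen_of_path (path_of_mem_orb (mem_orb_trans (mem_orb_symm hV) hW)))
  have h2 := level_le_of_reflTransGen
    (reflTransGen_of_path (path_of_mem_orb (mem_orb_trans (mem_orb_symm hW) hV)))
  grind

/-! ### Every orbit contains a normal form -/

lemma exists_vertex_of_mem_orb {M N : Mat2} (h : M ∈ orb N) (hN : ∃ V : Vertex, N ∈ orb V.mat) :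
    ∃ V : Vertex, M ∈ orb V.mat :=
  hN.imp fun _ hV => mem_orb_trans h hV

lemma exists_vertex_of_congr {a b g d : ℂ} (c x y u v : ℂ) (hc : ‖c‖ = 1)
    (hP : x * v - y * u ≠ 0)
    (h : ∃ V : Vertex,
      !![c * (conj x * (a * x + b * u) + conj u * (g * x + d * u)),
          c * (conj x * (a * y + b * v) + conj u * (g * y + d * v));
        c * (conj y * (a * x + b * u) + conj v * (g * x + d * u)),
          c * (conj y * (a * y + b * v) + conj v * (g * y + d * v))] ∈ orb V.mat) :
    ∃ V : Vertex, !![a, b; g, d] ∈ orb V.mat :=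
  exists_vertex_of_mem_orb
    (mem_orb_symm (mem_orb_of_entries c x y u v hc hP rfl rfl rfl rfl)) h

lemma sqrt_mul_sqrt_norm (z : ℂ) : ((√‖z‖ : ℝ) : ℂ) * ((√‖z‖ : ℝ) : ℂ) = ‖z‖ := by
  rw [← Complex.ofReal_mul, Real.mul_self_sqrt (norm_nonneg z)]

lemma sqrt_norm_ne_zero {z : ℂ} (hz : z ≠ 0) : ((√‖z‖ : ℝ) : ℂ) ≠ 0 := by
  simpa using hz

lemma norm_div_norm {z : ℂ} (hz : z ≠ 0) : ‖z / (‖z‖ : ℂ)‖ = 1 := by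
  rw [norm_div, Complex.norm_real, norm_norm, div_self (norm_ne_zero_iff.2 hz)]

lemma ofReal_norm_ne_zero {z : ℂ} (hz : z ≠ 0) : (‖z‖ : ℂ) ≠ 0 := by simpa using hz

lemma exists_vertex_unimodular (φ : ℝ) (h : φ ∈ Set.Ioc (-Real.pi) Real.pi) :
    ∃ V : Vertex, !![1, 0; 0, Complex.exp (φ * Complex.I)] ∈ orb V.mat := by
  rcases lt_trichotomy φ 0 with h0 | rfl | h0
  -- Exchanging the basis vectors and multiplying by `e^{iφ}` turns `1 ⊕ e^{-iφ}` into `1 ⊕ e^{iφ}`.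
  · refine ⟨diagTheta ⟨-φ, by linarith, by linarith [h.1]⟩, ?_⟩
    have e : Complex.exp (φ * Complex.I) * Complex.exp (-(φ * Complex.I)) = 1 := by
      rw [← Complex.exp_add]; simp
    refine mem_orb_of_entries (Complex.exp (φ * Complex.I)) 0 1 1 0
      (Complex.norm_exp_ofReal_mul_I φ) (by simp) ?_ ?_ ?_ ?_ <;> simp [e]
  · exact ⟨one, by simpa [Vertex.mat] using mem_orb_self _⟩
  · rcases eq_or_lt_of_le h.2 with rfl | h1
    · exact ⟨diagNeg, by simpa [Vertex.mat] using mem_orb_self _⟩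
    · exact ⟨diagTheta ⟨φ, h0, h1⟩, mem_orb_self _⟩

lemma exists_vertex_diag (a d : ℂ) : ∃ V : Vertex, !![a, 0; 0, d] ∈ orb V.mat := by
  rcases eq_or_ne a 0 with rfl | ha
  · rcases eq_or_ne d 0 with rfl | hd
    · exact ⟨Vertex.zero, mem_orb_self _⟩
    · refine ⟨rankOne, mem_orb_of_entries (d / ‖d‖) 0 (√‖d‖ : ℝ) 1 0 (norm_div_norm hd)
        (by simpa using sqrt_norm_ne_zero hd) ?_ ?_ ?_ ?_⟩ <;> simp
      rw [sqrt_mul_sqrt_norm, div_mul_cancel₀ _ (ofReal_norm_ne_zero hd)]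
  · rcases eq_or_ne d 0 with rfl | hd
    · refine ⟨rankOne, mem_orb_of_entries (a / ‖a‖) (√‖a‖ : ℝ) 0 0 1 (norm_div_norm ha)
        (by simpa using sqrt_norm_ne_zero ha) ?_ ?_ ?_ ?_⟩ <;> simp
      rw [sqrt_mul_sqrt_norm, div_mul_cancel₀ _ (ofReal_norm_ne_zero ha)]
    · refine exists_vertex_of_mem_orb ?_
        (exists_vertex_unimodular (Complex.arg (d / a)) (Complex.arg_mem_Ioc _))
      have ha' := ofReal_norm_ne_zero ha
      have hd' := ofReal_norm_ne_zero hd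
      have e : Complex.exp (Complex.arg (d / a) * Complex.I) = (d / a) / (‖d‖ / ‖a‖) := by
        rw [eq_div_iff (div_ne_zero hd' ha'), mul_comm]
        simpa using Complex.norm_mul_exp_arg_mul_I (d / a)
      refine mem_orb_of_entries (a / ‖a‖) (√‖a‖ : ℝ) 0 0 (√‖d‖ : ℝ) (norm_div_norm ha)
        (by simpa using ⟨ha, hd⟩) ?_ ?_ ?_ ?_ <;> simp
      · rw [sqrt_mul_sqrt_norm, div_mul_cancel₀ _ ha']
      · rw [e, mul_left_comm (√‖d‖ : ℂ), sqrt_mul_sqrt_norm]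
        field_simp

lemma exists_vertex_of_diag {M : Mat2} (h01 : M 0 1 = 0) (h10 : M 1 0 = 0) :
    ∃ V : Vertex, M ∈ orb V.mat := by
  rw [eta_fin_two M, h01, h10]
  exact exists_vertex_diag _ _

/-- A square root `c` of the direction of `a b`. With `P = (conj a * c) ⊕ 1` it carries `[0 1;
‖b‖/‖a‖ 0]` to `[0 a; b 0]`. -/
lemma exists_phase {a b : ℂ} (ha : a ≠ 0) : ∃ c : ℂ, ‖c‖ = 1 ∧ c ^ 2 * conj a * ‖b‖ = b * ‖a‖ := by
  rcases eq_or_ne b 0 with rfl | hb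
  · exact ⟨1, by simp⟩
  obtain ⟨c, hc⟩ := IsAlgClosed.exists_pow_nat_eq (a * b / (‖a * b‖ : ℂ)) (n := 2) (by norm_num)
  have hn : ‖c‖ = 1 := by
    have : ‖c‖ ^ 2 = 1 := by rw [← norm_pow, hc, norm_div_norm (mul_ne_zero ha hb)]
    nlinarith [norm_nonneg c]
  refine ⟨c, hn, ?_⟩
  have ha' := ofReal_norm_ne_zero ha
  have hb' := ofReal_norm_ne_zero hb
  rw [hc, norm_mul]
  push_cast
  field_simp
  rw [← Complex.mul_conj']

lemma exists_vertex_antidiag_of_lt {a b : ℂ} (h : ‖b‖ < ‖a‖) :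
    ∃ V : Vertex, !![0, a; b, 0] ∈ orb V.mat := by
  have ha : a ≠ 0 := norm_pos_iff.1 ((norm_nonneg b).trans_lt h)
  have ha' := ofReal_norm_ne_zero ha
  have hpos := norm_pos_iff.2 ha
  obtain ⟨c, hc, hcab⟩ := exists_phase (b := b) ha
  have hcc : c * conj c = 1 := by simp [Complex.mul_conj', hc]
  have hc0 : c ≠ 0 := left_ne_zero_of_mul_eq_one hcc
  have key : !![0, a; b, 0] ∈ orb !![0, 1; ((‖b‖ / ‖a‖ : ℝ) : ℂ), 0] := by
    refine mem_orb_of_entries c (conj a * c) 0 0 1 hc (by simp [ha, hc0]) ?_ ?_ ?_ ?_ <;> simp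
    · linear_combination -a * hcc
    · field_simp
      linear_combination -hcab
  rcases eq_or_ne b 0 with rfl | hb
  · exact ⟨nilp, by simpa [Vertex.mat] using key⟩
  · exact ⟨antiTau ⟨‖b‖ / ‖a‖, div_pos (norm_pos_iff.2 hb) hpos, (div_lt_one hpos).2 h⟩, key⟩

lemma exists_vertex_antidiag_of_ne {a b : ℂ} (h : ‖a‖ ≠ ‖b‖) :
    ∃ V : Vertex, !![0, a; b, 0] ∈ orb V.mat := by
  rcases lt_or_gt_of_ne h with h | h
  · refine exists_vertex_of_congr 1 0 1 1 0 (by simp) (by simp) ?_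
    simpa using exists_vertex_antidiag_of_lt h
  · exact exists_vertex_antidiag_of_lt h

lemma exists_vertex_anti_imaginary (η : ℝ) :
    ∃ V : Vertex, !![0, 1; 1, η * Complex.I] ∈ orb V.mat := by
  rcases eq_or_ne η 0 with rfl | hη
  · exact ⟨diagNeg, by simpa [swap] using swap_mem_orb⟩
  have hη' : (η : ℂ) ≠ 0 := by exact_mod_cast hη
  have hs := sqrt_norm_ne_zero hη'
  have hm := sqrt_mul_sqrt_norm (η : ℂ)
  rw [Complex.norm_real, Real.norm_eq_abs] at hs hm
  rcases lt_or_gt_of_ne hη with h | h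
  · rw [abs_of_neg h] at hs hm
    refine ⟨antiI, mem_orb_of_entries (-1) (-(√(-η) : ℂ)⁻¹) 0 0 (√(-η) : ℝ) (by simp)
      (by simp [hs]) ?_ ?_ ?_ ?_⟩ <;> simp [hs]
    push_cast at hm
    linear_combination Complex.I * hm
  · rw [abs_of_pos h] at hs hm
    refine ⟨antiI, mem_orb_of_entries 1 ((√η : ℂ)⁻¹) 0 0 (√η : ℝ) (by simp)
      (by simp [hs]) ?_ ?_ ?_ ?_⟩ <;> simp [hs]
    linear_combination -Complex.I * hm

/-- If `‖a‖ = ‖b‖`, a phase makes the antidiagonal `1, 1`, and a shear removes the real part of the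
last entry. Otherwise a shear by `y` removes all of it: `conj y * a + b * y + d = 0` is real linear
in `y` with determinant `‖b‖ ^ 2 - ‖a‖ ^ 2 ≠ 0`. -/
lemma exists_vertex_antitriangular (a b d : ℂ) :
    ∃ V : Vertex, !![0, a; b, d] ∈ orb V.mat := by
  by_cases hab : ‖a‖ = ‖b‖
  · rcases eq_or_ne a 0 with rfl | ha
    · have hb : b = 0 := by simpa using hab.symm
      subst hb
      exact exists_vertex_diag 0 d
    · have ha' := ofReal_norm_ne_zero ha
      obtain ⟨c, hc, hcab⟩ := exists_phase (b := b) ha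
      rw [← hab] at hcab
      replace hcab := mul_right_cancel₀ ha' hcab
      have hcc : c * conj c = 1 := by simp [Complex.mul_conj', hc]
      have hc0 : c ≠ 0 := left_ne_zero_of_mul_eq_one hcc
      have e : (d * conj c) = (d * conj c).re + (d * conj c).im * Complex.I :=
        (Complex.re_add_im _).symm
      refine exists_vertex_of_mem_orb ?_ (exists_vertex_anti_imaginary (d * conj c).im)
      refine mem_orb_of_entries c (conj a * c) (((d * conj c).re / 2 : ℝ) : ℂ) 0 1 hc
        (by simp [ha, hc0]) ?_ ?_ ?_ ?_
      · simp
      · simp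
        linear_combination -a * hcc
      · simp
        linear_combination -hcab
      · rw [Complex.conj_ofReal]
        generalize (d * conj c).re = p, (d * conj c).im = q at e
        simp
        linear_combination -d * hcc + c * e
  · have hne : conj b * b - conj a * a ≠ 0 := by
      rw [Complex.conj_mul', Complex.conj_mul', sub_ne_zero]
      intro h
      have h' : ‖b‖ ^ 2 = ‖a‖ ^ 2 := by exact_mod_cast h
      exact hab (by rw [sq_eq_sq₀ (norm_nonneg _) (norm_nonneg _)] at h'; exact h'.symm)
    refine exists_vertex_of_congr 1 1 ((conj d * a - d * conj b) / (conj b * b - conj a * a)) 0 1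
      (by simp) (by simp) ?_
    have e : conj ((conj d * a - d * conj b) / (conj b * b - conj a * a)) * a +
        (b * ((conj d * a - d * conj b) / (conj b * b - conj a * a)) + d) = 0 := by
      have hD : conj (conj b * b - conj a * a) = conj b * b - conj a * a := by
        simp [mul_comm]
      have hinv := mul_inv_cancel₀ hne
      rw [map_div₀, hD, div_eq_mul_inv, div_eq_mul_inv]
      simp only [map_sub, map_mul, Complex.conj_conj]
      linear_combination -d * hinv
    simpa only [map_one, map_zero, one_mul, zero_mul, mul_zero, mul_one, add_zero, zero_add, e]
      using exists_vertex_antidiag_of_ne hab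

/-- An isotropic vector as first column of `P`, completed by an orthogonal one, makes the upper left
entry vanish. -/
lemma exists_vertex_of_isotropic {a b g d p q : ℂ} (hpq : p ≠ 0 ∨ q ≠ 0)
    (h : conj p * (a * p + b * q) + conj q * (g * p + d * q) = 0) :
    ∃ V : Vertex, !![a, b; g, d] ∈ orb V.mat := by
  refine exists_vertex_of_congr 1 p (-conj q) q (conj p) (by simp) ?_ ?_
  · have : p * conj p - -conj q * q = ((‖p‖ ^ 2 + ‖q‖ ^ 2 : ℝ) : ℂ) := by
      push_cast
      rw [← Complex.mul_conj', ← Complex.conj_mul']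
      ring
    rw [this]
    norm_cast
    rcases hpq with h | h
    · have := norm_pos_iff.2 h; positivity
    · have := norm_pos_iff.2 h; positivity
  · rw [h, mul_zero]
    exact exists_vertex_antitriangular _ _ _

/-- The vector `(p, 1)` is isotropic iff `‖p‖ ^ 2 + p + d = 0`. This forces `Im p = -η` and leaves a
real quadratic for `Re p` with discriminant `1 - 4ξ - 4η ^ 2`, whose sign splits the proof. -/
lemma exists_vertex_triangular_one (d : ℂ) : ∃ V : Vertex, !![1, 0; 1, d] ∈ orb V.mat := by
  obtain ⟨ξ, η⟩ := d
  have hd : (⟨ξ, η⟩ : ℂ) = ξ + η * Complex.I := by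
    apply Complex.ext <;> simp
  rw [hd]
  have hI := Complex.I_sq
  rcases le_or_gt 0 (1 - 4 * ξ - 4 * η ^ 2) with h | h
  · have hr : ((√(1 - 4 * ξ - 4 * η ^ 2) : ℝ) : ℂ) ^ 2 = 1 - 4 * ξ - 4 * η ^ 2 := by
      rw [← Complex.ofReal_pow, Real.sq_sqrt h]; push_cast; ring
    refine exists_vertex_of_isotropic
      (p := (-1 + (√(1 - 4 * ξ - 4 * η ^ 2) : ℝ)) / 2 - η * Complex.I) (q := 1) (.inr one_ne_zero) ?_
    simp [Complex.conj_ofNat]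
    linear_combination hr / 4 - η ^ 2 * hI
  · set r : ℝ := √(4 * ξ + 4 * η ^ 2 - 1) with hrdef
    have hr : (r : ℂ) ^ 2 = 4 * ξ + 4 * η ^ 2 - 1 := by
      rw [hrdef, ← Complex.ofReal_pow, Real.sq_sqrt (by linarith)]; push_cast; ring
    have hr0 : (r : ℂ) ≠ 0 := by
      have : 0 < r := Real.sqrt_pos.2 (by linarith)
      exact_mod_cast this.ne'
    -- The columns are `(p₁, 1)` and `(p₂, 1)` with real parts `-1/2`, so that `1 + conj pⱼ = -pⱼ`.
    -- Both off-diagonal entries are then `d - p₁ p₂`, which is zero by the choice of `r`.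
    refine exists_vertex_of_congr 1 ((-1 + (-2 * η + r) * Complex.I) / 2)
      ((-1 + (-2 * η - r) * Complex.I) / 2) 1 1 (by simp) ?_ ?_
    · have : ((-1 + (-2 * η + r) * Complex.I) / 2) * 1 -
          ((-1 + (-2 * η - r) * Complex.I) / 2) * 1 = r * Complex.I := by ring
      rw [this]
      exact mul_ne_zero hr0 Complex.I_ne_zero
    · refine exists_vertex_of_diag ?_ ?_
      all_goals
        simp [Complex.conj_ofNat]
        linear_combination (-4 * η ^ 2 + r ^ 2) / 4 * hI - hr / 4

lemma exists_vertex_of_triangular_one {M : Mat2} (h00 : M 0 0 = 1) (h01 : M 0 1 = 0)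
    (h10 : M 1 0 = 1) : ∃ V : Vertex, M ∈ orb V.mat := by
  rw [eta_fin_two M, h00, h01, h10]
  exact exists_vertex_triangular_one _

lemma exists_vertex (M : Mat2) : ∃ V : Vertex, M ∈ orb V.mat := by
  rw [eta_fin_two M]
  generalize M 0 0 = a, M 0 1 = b, M 1 0 = g, M 1 1 = d
  rcases eq_or_ne a 0 with rfl | ha
  · exact exists_vertex_antitriangular _ _ _
  -- A shear clears the upper right entry; if the lower left one survives, diagonal scaling below
  -- turns it and the corner `a` into `1`.
  refine exists_vertex_of_congr 1 1 (-b / a) 0 1 (by simp) (by simp) ?_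
  have e : a * (-b / a) + b = 0 := by field_simp; ring
  simp only [e, map_zero, map_one, one_mul, zero_mul, mul_one, mul_zero, add_zero, zero_add]
  generalize conj (-b / a) * a + g = γ, g * (-b / a) + d = δ
  rcases eq_or_ne γ 0 with rfl | hγ
  · exact exists_vertex_diag _ _
  have ha' := ofReal_norm_ne_zero ha
  have hs := sqrt_norm_ne_zero ha
  have hm := sqrt_mul_sqrt_norm a
  refine exists_vertex_of_congr (‖a‖ / a) (√‖a‖ : ℂ)⁻¹ 0 0
    (conj (a * (√‖a‖ : ℂ) / (‖a‖ * γ))) ?_ ?_ ?_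
  · rw [norm_div, Complex.norm_real, norm_norm, div_self (norm_ne_zero_iff.2 ha)]
  · rw [zero_mul, sub_zero]
    refine mul_ne_zero (inv_ne_zero hs) ((map_ne_zero _).2 ?_)
    exact div_ne_zero (mul_ne_zero ha hs) (mul_ne_zero ha' hγ)
  · refine exists_vertex_of_triangular_one ?_ ?_ ?_
    · simp
      field_simp
      rw [sq, hm]
    · simp
    · simp
      field_simp

/-! ### Dimensions of the orbits -/

/-- The derivative of the orbit map of `A` at the identity, `(s, K) ↦ i s A + K* A + A K`. -/
noncomputable def infAct (A : Mat2) : ℝ × Mat2 →ₗ[ℝ] Mat2 where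
  toFun g := ((g.1 : ℂ) * Complex.I) • A + g.2ᴴ * A + A * g.2
  map_add' g h := by
    simp only [Prod.fst_add, Prod.snd_add, Complex.ofReal_add, conjTranspose_add, add_mul, mul_add,
      add_smul]
    abel
  map_smul' r g := by
    have h : ∀ X : Mat2, r • X = (r : ℂ) • X := fun X => by ext; simp
    simp only [Prod.smul_fst, Prod.smul_snd, h, conjTranspose_smul, RingHom.id_apply, smul_add,
      smul_smul, Matrix.smul_mul, Matrix.mul_smul, smul_eq_mul, Complex.ofReal_mul,
      Complex.star_def, Complex.conj_ofReal, mul_assoc]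

lemma infAct_apply (A : Mat2) (g : ℝ × Mat2) :
    infAct A g = ((g.1 : ℂ) * Complex.I) • A + g.2ᴴ * A + A * g.2 := rfl

lemma infAct_fin_two (a b g d k l m n : ℂ) (s : ℝ) :
    infAct !![a, b; g, d] (s, !![k, l; m, n]) =
      !![s * Complex.I * a + (conj k * a + conj m * g) + (a * k + b * m),
          s * Complex.I * b + (conj k * b + conj m * d) + (a * l + b * n);
        s * Complex.I * g + (conj l * a + conj n * g) + (g * k + d * m),
          s * Complex.I * d + (conj l * b + conj n * d) + (g * l + d * n)] := by
  rw [infAct_apply]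
  ext i j
  fin_cases i <;> fin_cases j <;> simp [Matrix.mul_apply, Fin.sum_univ_two]

/-- The real bilinear map `(X, Y) ↦ X* A Y`. -/
noncomputable def sesq (A : Mat2) : Mat2 →L[ℝ] Mat2 →L[ℝ] Mat2 :=
  (LinearMap.mk₂ ℝ (fun X Y : Mat2 => Xᴴ * A * Y) (by intros; simp [add_mul]) (by intros; simp)
    (by intros; simp [mul_add]) (by intros; simp)).toContinuousBilinearMap

lemma sesq_apply (A X Y : Mat2) : sesq A X Y = Xᴴ * A * Y := rfl

lemma fderiv_orbitMap (A : Mat2) (t : ℝ) (P : Mat2) (g : ℝ × Mat2) :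
    fderiv ℝ (orbitMap A) (t, P) g =
      Complex.exp (t * Complex.I) • (((g.1 : ℂ) * Complex.I) • (Pᴴ * A * P) +
        g.2ᴴ * A * P + Pᴴ * A * g.2) := by
  have h1 : HasFDerivAt (fun g : ℝ × Mat2 => (Circle.exp g.1 : ℂ))
      ((ContinuousLinearMap.toSpanSingleton ℝ (Complex.exp (t * Complex.I) * (1 * Complex.I))).comp
        (ContinuousLinearMap.fst ℝ ℝ Mat2)) (t, P) := by
    have h : HasDerivAt (fun t : ℝ => (Circle.exp t : ℂ))
        (Complex.exp (t * Complex.I) * (1 * Complex.I)) t := by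
      simp only [Circle.coe_exp]
      exact ((Complex.ofRealCLM.hasDerivAt (x := t)).mul_const Complex.I).cexp
    exact h.hasFDerivAt.comp (t, P) (hasFDerivAt_fst (𝕜 := ℝ) (p := (t, P)))
  have h2 : HasFDerivAt (fun g : ℝ × Mat2 => sesq A g.2 g.2) _ (t, P) :=
    (sesq A).hasFDerivAt_of_bilinear (hasFDerivAt_snd (𝕜 := ℝ) (p := (t, P)))
      (hasFDerivAt_snd (𝕜 := ℝ) (p := (t, P)))
  have h3 := h1.smul h2
  have h4 : HasFDerivAt (orbitMap A) _ (t, P) := h3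
  rw [h4.fderiv]
  change Complex.exp (t * Complex.I) • (sesq A P g.2 + sesq A g.2 P) +
    (g.1 • (Complex.exp (t * Complex.I) * (1 * Complex.I))) • sesq A P P = _
  simp only [sesq_apply, Complex.real_smul, smul_add, smul_smul, one_mul]
  rw [mul_left_comm]
  abel

lemma conj_inv_cancel (P : GL (Fin 2) ℂ) (X : Mat2) :
    (P : Mat2)ᴴ * (((P⁻¹ : GL (Fin 2) ℂ) : Mat2)ᴴ * X * ((P⁻¹ : GL (Fin 2) ℂ) : Mat2)) * (P : Mat2) =
      X := by
  have h1 : (P : Mat2)ᴴ * ((P⁻¹ : GL (Fin 2) ℂ) : Mat2)ᴴ = 1 := by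
    rw [← conjTranspose_mul, ← Units.val_mul]
    simp
  have h2 : ((P⁻¹ : GL (Fin 2) ℂ) : Mat2) * (P : Mat2) = 1 := by
    rw [← Units.val_mul]
    simp
  rw [Matrix.mul_assoc, Matrix.mul_assoc, h2, Matrix.mul_one, ← Matrix.mul_assoc, h1, Matrix.one_mul]

/-- `X ↦ z P* X P` as a real linear equivalence. -/
noncomputable def congrEquiv (z : ℂˣ) (P : GL (Fin 2) ℂ) : Mat2 ≃ₗ[ℝ] Mat2 :=
  LinearEquiv.ofLinearMap
    (LinearMap.mk ⟨fun X => (z : ℂ) • ((P : Mat2)ᴴ * X * (P : Mat2)),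
      by intros; simp [mul_add, add_mul]⟩ (by intro r X; simp only [Matrix.mul_smul, Matrix.smul_mul, RingHom.id_apply]; rw [smul_comm]))
    (LinearMap.mk ⟨fun X => ((z⁻¹ : ℂˣ) : ℂ) • (((P⁻¹ : GL (Fin 2) ℂ) : Mat2)ᴴ * X *
      ((P⁻¹ : GL (Fin 2) ℂ) : Mat2)), by intros; simp [mul_add, add_mul]⟩
      (by intro r X; simp only [Matrix.mul_smul, Matrix.smul_mul, RingHom.id_apply]; rw [smul_comm]))
    (by
      refine LinearMap.ext fun X => ?_
      change (z : ℂ) • ((P : Mat2)ᴴ * (((z⁻¹ : ℂˣ) : ℂ) • (((P⁻¹ : GL (Fin 2) ℂ) : Mat2)ᴴ * X *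
        ((P⁻¹ : GL (Fin 2) ℂ) : Mat2))) * (P : Mat2)) = X
      rw [Matrix.mul_smul, Matrix.smul_mul, smul_smul, Units.mul_inv, one_smul]
      exact conj_inv_cancel P X)
    (by
      refine LinearMap.ext fun X => ?_
      change ((z⁻¹ : ℂˣ) : ℂ) • (((P⁻¹ : GL (Fin 2) ℂ) : Mat2)ᴴ * ((z : ℂ) • ((P : Mat2)ᴴ * X *
        (P : Mat2))) * ((P⁻¹ : GL (Fin 2) ℂ) : Mat2)) = X
      rw [Matrix.mul_smul, Matrix.smul_mul, smul_smul, Units.inv_mul, one_smul]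
      simpa using conj_inv_cancel P⁻¹ X)

/-- `(s, H) ↦ (s, H P⁻¹)` as a real linear equivalence. -/
noncomputable def rightMulEquiv (P : GL (Fin 2) ℂ) : (ℝ × Mat2) ≃ₗ[ℝ] (ℝ × Mat2) :=
  (LinearEquiv.refl ℝ ℝ).prodCongr
    (LinearEquiv.ofLinearMap
      (LinearMap.mk ⟨fun X => X * ((P⁻¹ : GL (Fin 2) ℂ) : Mat2), by intros; simp [add_mul]⟩
        (by intros; simp))
      (LinearMap.mk ⟨fun X => X * (P : Mat2), by intros; simp [add_mul]⟩ (by intros; simp))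
      (by ext1 X; simp [Matrix.mul_assoc])
      (by ext1 X; simp [Matrix.mul_assoc]))

/-- Equivariance: the derivative at `(t, P)` is `infAct A` composed with invertible maps on both
sides, so the rank is the same at all group elements. -/
lemma finrank_range_fderiv (A : Mat2) (t : ℝ) (P : GL (Fin 2) ℂ) :
    Module.finrank ℝ (LinearMap.range (fderiv ℝ (orbitMap A) (t, (P : Mat2))).toLinearMap) =
      Module.finrank ℝ (LinearMap.range (infAct A)) := by
  have h : (fderiv ℝ (orbitMap A) (t, (P : Mat2))).toLinearMap =
      (congrEquiv (Units.mk0 _ (Complex.exp_ne_zero (t * Complex.I))) P).toLinearMap ∘ₗ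
        infAct A ∘ₗ (rightMulEquiv P).toLinearMap := by
    refine LinearMap.ext fun g => ?_
    have h1 : (P : Mat2)ᴴ * (g.2 * ((P⁻¹ : GL (Fin 2) ℂ) : Mat2))ᴴ = g.2ᴴ := by
      rw [← conjTranspose_mul, Matrix.mul_assoc, ← Units.val_mul]
      simp
    have h2 : (g.2 * ((P⁻¹ : GL (Fin 2) ℂ) : Mat2)) * (P : Mat2) = g.2 := by
      rw [Matrix.mul_assoc, ← Units.val_mul]
      simp
    change fderiv ℝ (orbitMap A) (t, (P : Mat2)) g = Complex.exp (t * Complex.I) •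
      ((P : Mat2)ᴴ * infAct A (g.1, g.2 * ((P⁻¹ : GL (Fin 2) ℂ) : Mat2)) * (P : Mat2))
    rw [fderiv_orbitMap, infAct_apply]
    simp only [mul_add, add_mul, Matrix.mul_smul, Matrix.smul_mul]
    rw [← Matrix.mul_assoc (P : Mat2)ᴴ _ A, h1, ← Matrix.mul_assoc (P : Mat2)ᴴ A,
      Matrix.mul_assoc ((P : Mat2)ᴴ * A), h2]
  rw [h, LinearMap.range_comp, LinearEquiv.finrank_map_eq, LinearMap.range_comp,
    LinearEquiv.range, Submodule.map_top]

lemma hasOrbitDim_of_equations {A : Mat2} {W : Type*} [AddCommGroup W] [Module ℝ W]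
    (φ : Mat2 →ₗ[ℝ] W) (hφ : Function.Surjective φ)
    (h : ∀ X : Mat2, φ X = 0 ↔ ∃ g, infAct A g = X) {d : ℕ} (hd : d + Module.finrank ℝ W = 8) :
    HasOrbitDim A d := by
  intro t P
  rw [finrank_range_fderiv]
  have hker : LinearMap.range (infAct A) = LinearMap.ker φ := by
    ext X
    rw [LinearMap.mem_ker, h, LinearMap.mem_range]
  have h8 : Module.finrank ℝ Mat2 = 8 := by
    rw [Module.finrank_matrix, Complex.finrank_real_complex]
    simp
  have := φ.finrank_range_add_finrank_ker
  rw [LinearMap.range_eq_top.2 hφ, finrank_top, h8] at this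
  rw [hker]
  omega

lemma exists_infAct_iff (a b g d : ℂ) (X : Mat2) :
    (∃ p, infAct !![a, b; g, d] p = X) ↔ ∃ (s : ℝ) (k l m n : ℂ),
      s * Complex.I * a + (conj k * a + conj m * g) + (a * k + b * m) = X 0 0 ∧
      s * Complex.I * b + (conj k * b + conj m * d) + (a * l + b * n) = X 0 1 ∧
      s * Complex.I * g + (conj l * a + conj n * g) + (g * k + d * m) = X 1 0 ∧
      s * Complex.I * d + (conj l * b + conj n * d) + (g * l + d * n) = X 1 1 := by
  constructor
  · rintro ⟨⟨s, K⟩, rfl⟩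
    rw [eta_fin_two K, infAct_fin_two]
    exact ⟨s, K 0 0, K 0 1, K 1 0, K 1 1, rfl, rfl, rfl, rfl⟩
  · rintro ⟨s, k, l, m, n, h00, h01, h10, h11⟩
    refine ⟨(s, !![k, l; m, n]), ?_⟩
    rw [infAct_fin_two, h00, h01, h10, h11]
    exact (eta_fin_two X).symm

lemma finrank_real_prod_complex : Module.finrank ℝ (ℝ × ℂ) = 3 := by
  rw [Module.finrank_prod, Complex.finrank_real_complex, Module.finrank_self]

lemma finrank_complex_prod_complex : Module.finrank ℝ (ℂ × ℂ) = 4 := by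
  rw [Module.finrank_prod, Complex.finrank_real_complex]

/-- The entry `X i j` as a real linear map. -/
def entryMap (i j : Fin 2) : Mat2 →ₗ[ℝ] ℂ where
  toFun X := X i j
  map_add' _ _ := rfl
  map_smul' _ _ := rfl

@[simp] lemma entryMap_apply (i j : Fin 2) (X : Mat2) : entryMap i j X = X i j := rfl

/-- With `w = p + iq` the tangent space is `Im X₀₀ = Im (conj w * X₁₁)`: both diagonal entries turn
by the same phase. The off-diagonal entries are free because `X₀₁ - conj X₁₀ = 2 i q conj m` can be
solved for `m`. -/
lemma hasOrbitDim_diag {p q : ℝ} (hpq : p ^ 2 + q ^ 2 = 1) (hq : q ≠ 0) :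
    HasOrbitDim !![1, 0; 0, ⟨p, q⟩] 7 := by
  refine hasOrbitDim_of_equations (W := ℝ)
    (Complex.imLm ∘ₗ entryMap 0 0 - p • (Complex.imLm ∘ₗ entryMap 1 1)
      + q • (Complex.reLm ∘ₗ entryMap 1 1)) ?_ ?_ (by simp)
  · intro r
    exact ⟨!![r * Complex.I, 0; 0, 0], by simp⟩
  · intro X
    rw [exists_infAct_iff]
    constructor
    · intro h
      simp at h
      generalize hm1 : ((X 0 1).im + (X 1 0).im) / (2 * q) = m₁
      generalize hm2 : ((X 0 1).re - (X 1 0).re) / (2 * q) = m₂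
      rw [div_eq_iff (by simpa using hq)] at hm1 hm2
      refine ⟨(X 0 0).im, ⟨(X 0 0).re / 2, 0⟩,
        ⟨(X 0 1).re - (p * m₁ + q * m₂), (X 0 1).im - (q * m₁ - p * m₂)⟩, ⟨m₁, m₂⟩,
        ⟨(p * (X 1 1).re + q * (X 1 1).im) / 2, 0⟩, ?_, ?_, ?_, ?_⟩ <;>
      apply Complex.ext <;> simp
      · ring
      · ring
      · linear_combination hm2
      · linear_combination -hm1
      · linear_combination -q * h + (X 1 1).re * hpq
      · linear_combination p * h + (X 1 1).im * hpq
    · rintro ⟨s, k, l, m, n, h00, h01, h10, h11⟩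
      simp [← h00, ← h11]
      linear_combination -s * hpq

/-- For a real `σ` the off-diagonal entries of a tangent vector are conjugate, which adds two real
equations to `Im X₀₀ = σ Im X₁₁`. -/
lemma hasOrbitDim_diag_of_sq {σ : ℝ} (hσ : σ ^ 2 = 1) : HasOrbitDim !![1, 0; 0, (σ : ℂ)] 5 := by
  refine hasOrbitDim_of_equations (W := ℝ × ℂ)
    ((Complex.imLm ∘ₗ (entryMap 0 0 - σ • entryMap 1 1)).prod
      (entryMap 1 0 - Complex.conjLIE.toLinearEquiv.toLinearMap ∘ₗ entryMap 0 1)) ?_ ?_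
      (by rw [finrank_real_prod_complex])
  · rintro ⟨r, z⟩
    exact ⟨!![r * Complex.I, 0; z, 0], by simp⟩
  · intro X
    rw [exists_infAct_iff]
    constructor
    · intro h
      simp [sub_eq_zero] at h
      refine ⟨(X 0 0).im, ⟨(X 0 0).re / 2, 0⟩, X 0 1, 0, ⟨σ * (X 1 1).re / 2, 0⟩, ?_, ?_, ?_, ?_⟩
      · apply Complex.ext <;> simp
      · simp
      · simp [h.2]
      · apply Complex.ext <;> simp
        · linear_combination (X 1 1).re * hσ
        · linear_combination σ * h.1 + (X 1 1).im * hσ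
    · rintro ⟨s, k, l, m, n, h00, h01, h10, h11⟩
      simp [← h00, ← h01, ← h10, ← h11, sub_eq_zero]
      constructor
      · linear_combination - s * hσ
      · ring

lemma hasOrbitDim_rankOne : HasOrbitDim !![1, 0; 0, 0] 4 := by
  refine hasOrbitDim_of_equations (W := ℂ × ℂ)
    ((entryMap 1 1).prod
      (entryMap 1 0 - Complex.conjLIE.toLinearEquiv.toLinearMap ∘ₗ entryMap 0 1)) ?_ ?_
      (by rw [finrank_complex_prod_complex])
  · rintro ⟨r, z⟩
    exact ⟨!![0, 0; z, r], by simp⟩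
  · intro X
    rw [exists_infAct_iff]
    constructor
    · intro h
      simp [sub_eq_zero] at h
      refine ⟨(X 0 0).im, ⟨(X 0 0).re / 2, 0⟩, X 0 1, 0, 0, ?_, ?_, ?_, ?_⟩
      · apply Complex.ext <;> simp
      · simp
      · simp [h.2]
      · simp [h.1]
    · rintro ⟨s, k, l, m, n, h00, h01, h10, h11⟩
      simp [← h01, ← h10, ← h11]

lemma hasOrbitDim_nilp : HasOrbitDim !![0, 1; 0, 0] 6 := by
  refine hasOrbitDim_of_equations (W := ℂ) (entryMap 1 0) ?_ ?_
      (by rw [Complex.finrank_real_complex])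
  · intro z
    exact ⟨!![0, 0; z, 0], by simp⟩
  · intro X
    rw [exists_infAct_iff]
    constructor
    · intro h
      refine ⟨0, 0, conj (X 1 1), X 0 0, X 0 1, ?_, ?_, ?_, ?_⟩ <;> simp
      simpa using h.symm
    · rintro ⟨s, k, l, m, n, h00, h01, h10, h11⟩
      simp [← h10]

lemma hasOrbitDim_antiTau {τ : ℝ} (h0 : 0 < τ) (h1 : τ < 1) :
    HasOrbitDim !![0, 1; (τ : ℂ), 0] 7 := by
  have hp : 1 + τ ≠ 0 := by linarith
  have hm : 1 - τ ≠ 0 := by linarith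
  have hτ := h0.ne'
  refine hasOrbitDim_of_equations (W := ℝ)
    (Complex.reLm ∘ₗ (entryMap 1 0 - τ • entryMap 0 1)) ?_ ?_ (by simp)
  · intro r
    exact ⟨!![0, 0; r, 0], by simp⟩
  · intro X
    rw [exists_infAct_iff]
    constructor
    · intro h
      simp [sub_eq_zero] at h
      refine ⟨((X 0 1).im + (X 1 0).im / τ) / 2, 0,
        ⟨(X 1 1).re / (1 + τ), -(X 1 1).im / (1 - τ)⟩, ⟨(X 0 0).re / (1 + τ), (X 0 0).im / (1 - τ)⟩,
        ⟨(X 0 1).re, ((X 0 1).im - (X 1 0).im / τ) / 2⟩, ?_, ?_, ?_, ?_⟩ <;>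
      apply Complex.ext <;> simp [h] <;> field_simp <;> ring_nf
    · rintro ⟨s, k, l, m, n, h00, h01, h10, h11⟩
      simp [← h01, ← h10]
      ring

lemma hasOrbitDim_antiI : HasOrbitDim !![0, 1; 1, Complex.I] 7 := by
  refine hasOrbitDim_of_equations (W := ℝ) (Complex.imLm ∘ₗ entryMap 0 0) ?_ ?_ (by simp)
  · intro r
    exact ⟨!![r * Complex.I, 0; 0, 0], by simp⟩
  · intro X
    rw [exists_infAct_iff]
    constructor
    · intro h
      simp at h
      -- The imaginary part of `X₀₁ + X₁₀` is `2 s + 2 Re m`, while `X₀₀ = 2 Re m`.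
      generalize hs : ((X 0 1).im + (X 1 0).im) / 2 - (X 0 0).re / 2 = s
      refine ⟨s, ⟨(X 0 1).re - (X 1 1).im / 2 - ((X 0 1).re - (X 1 0).re) / 2,
          -(X 0 1).im + (X 0 0).re / 2 + s⟩,
        ⟨((X 1 1).re + s) / 2, 0⟩, ⟨(X 0 0).re / 2, ((X 0 1).re - (X 1 0).re) / 2⟩,
        ⟨(X 1 1).im / 2, 0⟩, ?_, ?_, ?_, ?_⟩ <;>
      apply Complex.ext <;> simp [h, ← hs] <;> ring
    · rintro ⟨s, k, l, m, n, h00, h01, h10, h11⟩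
      simp [← h00]

lemma hasOrbitDim_zero : HasOrbitDim !![0, 0; 0, 0] 0 := by
  refine hasOrbitDim_of_equations (W := Mat2) LinearMap.id Function.surjective_id ?_ ?_
  · intro X
    rw [exists_infAct_iff]
    constructor
    · intro h
      simp only [LinearMap.id_apply] at h
      simp [h]
    · rintro ⟨s, k, l, m, n, h00, h01, h10, h11⟩
      ext i j
      fin_cases i <;> fin_cases j <;> simp [← h00, ← h01, ← h10, ← h11]
  · rw [Module.finrank_matrix, Complex.finrank_real_complex]
    simp

lemma hasOrbitDim_vertex (V : Vertex) : HasOrbitDim V.mat V.level := by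
  rcases V with θ | τ | _ | _ | _ | _ | _ | _
  · have e : Complex.exp ((θ : ℝ) * Complex.I) = ⟨Real.cos θ, Real.sin θ⟩ := by
      apply Complex.ext <;> simp [Complex.exp_ofReal_mul_I_re, Complex.exp_ofReal_mul_I_im]
    simp only [Vertex.mat, e]
    exact hasOrbitDim_diag (Real.cos_sq_add_sin_sq θ)
      (Real.sin_pos_of_pos_of_lt_pi θ.2.1 θ.2.2).ne'
  · exact hasOrbitDim_antiTau τ.2.1 τ.2.2
  · exact hasOrbitDim_antiI
  · exact hasOrbitDim_nilp
  · simpa [Vertex.mat, Vertex.level] using hasOrbitDim_diag_of_sq (σ := -1) (by norm_num)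
  · simpa [Vertex.mat, Vertex.level] using hasOrbitDim_diag_of_sq (σ := 1) (by norm_num)
  · exact hasOrbitDim_rankOne
  · exact hasOrbitDim_zero

/-! ### Estimates -/

/-- All entries of `P* A P - c⁻¹ B`, where `A = [a b; g d]`, `B = [α β; γ ω]`, `P = [x y; u v]`,
have modulus at most `r`. -/
def EntryBound (a b g d α β γ ω c x y u v : ℂ) (r : ℝ) : Prop :=
  ‖conj x * (a * x + b * u) + conj u * (g * x + d * u) - c⁻¹ * α‖ ≤ r ∧
  ‖conj x * (a * y + b * v) + conj u * (g * y + d * v) - c⁻¹ * β‖ ≤ r ∧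
  ‖conj y * (a * x + b * u) + conj v * (g * x + d * u) - c⁻¹ * γ‖ ≤ r ∧
  ‖conj y * (a * y + b * v) + conj v * (g * y + d * v) - c⁻¹ * ω‖ ≤ r

/-- Dividing by the unimodular `c` preserves moduli and moves `c` onto the target matrix. -/
lemma norm_pert_le_iff (a b g d α β γ ω : ℂ) (c : Circle) (P : GL (Fin 2) ℂ) {r : ℝ} (hr : 0 ≤ r) :
    ‖pert !![α, β; γ, ω] !![a, b; g, d] c P‖ ≤ r ↔
      EntryBound a b g d α β γ ω c ((P : Mat2) 0 0) ((P : Mat2) 0 1) ((P : Mat2) 1 0)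
        ((P : Mat2) 1 1) r := by
  have h : ∀ z w : ℂ, ‖(c : ℂ) * z - w‖ = ‖z - (c : ℂ)⁻¹ * w‖ := fun z w => by
    have : (c : ℂ) * z - w = c * (z - (c : ℂ)⁻¹ * w) := by
      have := c.coe_ne_zero
      field_simp
    rw [this, norm_mul, Circle.norm_coe, one_mul]
  rw [Matrix.norm_le_iff hr, pert, act_fin_two c P a b g d rfl rfl rfl rfl]
  simp [Fin.forall_fin_two, EntryBound, h, and_assoc]

lemma exists_bound {a b g d α β γ ω : ℂ} {F : Exprs} (ν : ℝ) (hν : 0 < ν)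
    (h : ∀ (c : ℂ) (x y u v : ℂ) (e : ℝ), ‖c‖ = 1 → 0 ≤ e → EntryBound a b g d α β γ ω c x y u v e →
      ∃ k : ℤ, ∀ z ∈ F c x y u v k, ‖z‖ ≤ ν * e) :
    ∃ ν : ℝ, 0 < ν ∧ ∀ (c : Circle) (P : GL (Fin 2) ℂ),
      Small !![α, β; γ, ω] !![a, b; g, d] c P →
        ∃ k : ℤ, BoundedBy F c P k (ν * ‖pert !![α, β; γ, ω] !![a, b; g, d] c P‖) :=
  ⟨ν, hν, fun c P _ => h c _ _ _ _ _ (Circle.norm_coe c) (norm_nonneg _)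
    ((norm_pert_le_iff _ _ _ _ _ _ _ _ c P (norm_nonneg _)).1 le_rfl)⟩

lemma exists_converse_bound {a b g d α β γ ω : ℂ} {free : Prop} {F : Exprs} (ρ : ℝ) (hρ : 0 < ρ)
    (h : ∀ (c : ℂ) (x y u v : ℂ) (k : ℤ) (s : ℝ), ‖c‖ = 1 → 0 < s → s ≤ √s → s ≤ 1 →
      (free ∨ c = (-1) ^ k) → (∀ z ∈ F c x y u v k, ‖z‖ ≤ s) →
      EntryBound a b g d α β γ ω c x y u v (ρ * √s)) :
    ∃ ρ : ℝ, 0 < ρ ∧ ∀ (s : ℝ), 0 < s → s ≤ 1 →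
      ∀ (c : Circle) (P : GL (Fin 2) ℂ) (k : ℤ), (free ∨ (c : ℂ) = (-1) ^ k) →
        BoundedBy F c P k s → ‖pert !![α, β; γ, ω] !![a, b; g, d] c P‖ ≤ ρ * √s := by
  refine ⟨ρ, hρ, fun s hs hs1 c P k hk hF => ?_⟩
  rw [norm_pert_le_iff _ _ _ _ _ _ _ _ c P (by positivity)]
  exact h c _ _ _ _ k s (Circle.norm_coe c) hs (Real.le_sqrt_of_sq_le (by nlinarith)) hs1 hk hF

/-! ### Unimodular numbers near `±1`, and elementary lower bounds. -/

lemma inv_eq_conj {c : ℂ} (hc : ‖c‖ = 1) : c⁻¹ = conj c := Complex.inv_eq_conj hc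

lemma re_sq_add_im_sq {c : ℂ} (hc : ‖c‖ = 1) : c.re ^ 2 + c.im ^ 2 = 1 := by
  have := Complex.sq_norm c
  rw [hc, Complex.normSq_apply] at this
  linarith

/-- Here `‖c - 1‖ ^ 2 = 2 (1 - Re c)`, and `1 - Re c ≤ 1 - (Re c) ^ 2 = (Im c) ^ 2` when `Re c ≥ 0`.
-/
lemma norm_sub_one_le {c : ℂ} (hc : ‖c‖ = 1) (h : 0 ≤ c.re) : ‖c - 1‖ ≤ 2 * |c.im| := by
  have h1 := re_sq_add_im_sq hc
  have h2 : ‖c - 1‖ ^ 2 ≤ (2 * |c.im|) ^ 2 := by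
    rw [Complex.sq_norm, Complex.normSq_apply, mul_pow, sq_abs]
    simp
    nlinarith
  exact le_of_sq_le_sq h2 (by positivity)

lemma exists_sign {c : ℂ} (hc : ‖c‖ = 1) : ∃ k : ℤ, ‖c - (-1) ^ k‖ ≤ 2 * |c.im| := by
  rcases le_total 0 c.re with h | h
  · exact ⟨0, by simpa using norm_sub_one_le hc h⟩
  · refine ⟨1, ?_⟩
    have := norm_sub_one_le (c := -c) (by simpa using hc) (by simpa using h)
    have e : c - (-1) ^ (1 : ℤ) = -(-c - 1) := by rw [zpow_one]; ring
    rw [e, norm_neg]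
    simpa using this

lemma norm_sub_one_le_of_nonneg {c : ℂ} (hc : ‖c‖ = 1) {r e : ℝ} (hr : 0 ≤ r)
    (h : ‖(r : ℂ) - c⁻¹‖ ≤ e) : ‖c - 1‖ ≤ 4 * e := by
  rw [inv_eq_conj hc] at h
  have h1 := (Complex.abs_re_le_norm _).trans h
  have h2 := (Complex.abs_im_le_norm _).trans h
  simp at h1 h2
  rw [abs_le] at h1
  rcases le_total 0 c.re with h0 | h0
  · have := norm_sub_one_le hc h0
    linarith [abs_nonneg c.im]
  -- On the wrong half circle the error is large: `1 ≤ |Re c| + |Im c| ≤ 2 e`.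
  · have h3 := Complex.norm_le_abs_re_add_abs_im c
    rw [hc, abs_of_nonpos h0] at h3
    have h4 : ‖c - 1‖ ≤ 2 := (norm_sub_le _ _).trans (by rw [hc, norm_one]; norm_num)
    linarith

/-- If `c⁻²` is close to a nonnegative number, then `c` is close to `±1`. -/
lemma abs_im_le_of_sq {c : ℂ} (hc : ‖c‖ = 1) {r δ : ℝ} (hr : 0 ≤ r)
    (h : ‖(r : ℂ) - c⁻¹ ^ 2‖ ≤ δ) : |c.im| ≤ 2 * δ := by
  rw [inv_eq_conj hc] at h
  have h1 := (Complex.abs_re_le_norm _).trans h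
  have h2 := (Complex.abs_im_le_norm _).trans h
  simp [sq] at h1 h2
  have hn := re_sq_add_im_sq hc
  have hδ : 0 ≤ δ := (norm_nonneg _).trans h
  -- For large `δ` the bound is trivial. Otherwise `|Re c| ≥ 1/2`, and `Im (c⁻¹ ^ 2) = -2 Re c Im c`
  -- controls `Im c`.
  rcases le_or_gt (1 / 2) δ with hd | hd
  · have := Complex.abs_im_le_norm c
    rw [hc] at this
    linarith
  · rw [abs_le] at h1
    have h3 : (1 / 2 : ℝ) ^ 2 ≤ c.re ^ 2 := by nlinarith
    have h4 : 1 / 2 ≤ |c.re| := by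
      rw [← abs_of_pos (by norm_num : (0 : ℝ) < 1 / 2)]
      exact sq_le_sq.1 h3
    have h5 : |c.re * c.im| ≤ δ / 2 := by
      rw [abs_le] at h2 ⊢
      constructor <;> linarith
    rw [abs_mul] at h5
    nlinarith [abs_nonneg c.im]

lemma norm_det_sub_le {m₁ m₂ m₃ m₄ n₁ n₂ n₃ n₄ : ℂ} {e : ℝ} (h1 : ‖m₁ - n₁‖ ≤ e)
    (h2 : ‖m₂ - n₂‖ ≤ e) (h3 : ‖m₃ - n₃‖ ≤ e) (h4 : ‖m₄ - n₄‖ ≤ e) (k1 : ‖n₁‖ ≤ 1)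
    (k2 : ‖n₂‖ ≤ 1) (k3 : ‖n₃‖ ≤ 1) (k4 : ‖n₄‖ ≤ 1) :
    ‖m₁ * m₄ - m₂ * m₃ - (n₁ * n₄ - n₂ * n₃)‖ ≤ 4 * e + 2 * e ^ 2 := by
  have he : 0 ≤ e := (norm_nonneg _).trans h1
  have key : ∀ {m n m' n' : ℂ}, ‖m - n‖ ≤ e → ‖m' - n'‖ ≤ e → ‖n‖ ≤ 1 → ‖n'‖ ≤ 1 →
      ‖m * m' - n * n'‖ ≤ 2 * e + e ^ 2 := by
    intro m n m' n' h h' k k'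
    have e1 : m * m' - n * n' = (m - n) * (m' - n') + (m - n) * n' + n * (m' - n') := by ring
    rw [e1]
    refine (norm_add₃_le).trans ?_
    rw [norm_mul, norm_mul, norm_mul]
    have a1 := mul_le_mul h h' (norm_nonneg _) he
    have a2 := mul_le_mul h k' (norm_nonneg _) he
    have a3 := mul_le_mul k h' (norm_nonneg _) zero_le_one
    linarith
  have e2 : m₁ * m₄ - m₂ * m₃ - (n₁ * n₄ - n₂ * n₃) =
      (m₁ * m₄ - n₁ * n₄) - (m₂ * m₃ - n₂ * n₃) := by ring
  rw [e2]
  refine (norm_sub_le _ _).trans ?_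
  linarith [key h1 h4 k1 k4, key h2 h3 k2 k3]

/-- The determinant argument: if `P* A P` is close to `c⁻¹ B`, where `det A = det B = -τ ≤ 0`, then
`c` is close to `±1`. -/
lemma mul_abs_im_le {a b g d α β γ ω c x y u v : ℂ} {e τ : ℝ} (hc : ‖c‖ = 1)
    (h : EntryBound a b g d α β γ ω c x y u v e) (hα : ‖α‖ ≤ 1) (hβ : ‖β‖ ≤ 1) (hγ : ‖γ‖ ≤ 1)
    (hω : ‖ω‖ ≤ 1) (hτ : 0 ≤ τ) (hτ1 : τ ≤ 1) (hA : a * d - b * g = -τ) (hB : α * ω - β * γ = -τ) :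
    τ * |c.im| ≤ 12 * e := by
  obtain ⟨h1, h2, h3, h4⟩ := h
  have he : 0 ≤ e := (norm_nonneg _).trans h1
  have hci : ‖c⁻¹‖ = 1 := by rw [norm_inv, hc, inv_one]
  have hu : ∀ {z : ℂ}, ‖z‖ ≤ 1 → ‖c⁻¹ * z‖ ≤ 1 := fun {z} hz => by rwa [norm_mul, hci, one_mul]
  have him : |c.im| ≤ 1 := hc ▸ Complex.abs_im_le_norm c
  rcases le_or_gt e 1 with he1 | he1
  swap
  · nlinarith [abs_nonneg c.im]
  rcases hτ.eq_or_lt with rfl | hτ0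
  · simpa using he
  have hdet := norm_det_sub_le h1 h2 h3 h4 (hu hα) (hu hβ) (hu hγ) (hu hω)
  have e1 : (conj x * (a * x + b * u) + conj u * (g * x + d * u)) *
        (conj y * (a * y + b * v) + conj v * (g * y + d * v)) -
      (conj x * (a * y + b * v) + conj u * (g * y + d * v)) *
        (conj y * (a * x + b * u) + conj v * (g * x + d * u)) -
      (c⁻¹ * α * (c⁻¹ * ω) - c⁻¹ * β * (c⁻¹ * γ)) =
      (-τ : ℂ) * (((‖x * v - y * u‖ ^ 2 : ℝ) : ℂ) - c⁻¹ ^ 2) := by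
    push_cast
    rw [← Complex.mul_conj']
    simp only [map_sub, map_mul]
    linear_combination (x * v - y * u) * (conj x * conj v - conj y * conj u) * hA - c⁻¹ ^ 2 * hB
  rw [e1, norm_mul, norm_neg, Complex.norm_real, Real.norm_eq_abs, abs_of_pos hτ0] at hdet
  -- For `e ≤ 1` the determinant error `4 e + 2 e ^ 2` is at most `6 e`.
  have h5 : ‖((‖x * v - y * u‖ ^ 2 : ℝ) : ℂ) - c⁻¹ ^ 2‖ ≤ 6 * e / τ := by
    rw [le_div_iff₀ hτ0]
    nlinarith
  have h6 := abs_im_le_of_sq hc (by positivity) h5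
  have h7 := mul_le_mul_of_nonneg_left h6 hτ
  have h8 : τ * (2 * (6 * e / τ)) = 12 * e := by field_simp; ring
  linarith

/-- Replacing `c⁻¹` by a nearby sign. -/
lemma norm_sub_sign_mul_le {c z ω : ℂ} {k : ℤ} {e K : ℝ} (hc : ‖c‖ = 1) (h : ‖z - c⁻¹ * ω‖ ≤ e)
    (hω : ‖ω‖ ≤ 1) (hk : ‖c - (-1) ^ k‖ ≤ K) : ‖z - (-1) ^ k * ω‖ ≤ e + K := by
  have h1 : ‖c⁻¹ - (-1) ^ k‖ ≤ K := by
    rw [inv_eq_conj hc, ← Complex.norm_conj]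
    simpa using hk
  have e1 : z - (-1) ^ k * ω = (z - c⁻¹ * ω) + (c⁻¹ - (-1) ^ k) * ω := by ring
  rw [e1]
  refine (norm_add_le _ _).trans (add_le_add h ?_)
  rw [norm_mul]
  calc ‖c⁻¹ - (-1) ^ k‖ * ‖ω‖ ≤ K * 1 :=
        mul_le_mul h1 hω (norm_nonneg _) ((norm_nonneg _).trans h1)
    _ = K := mul_one K

lemma abs_im_le_of_real {c : ℂ} (hc : ‖c‖ = 1) {r e : ℝ} (h : ‖(r : ℂ) - c⁻¹‖ ≤ e) :
    |c.im| ≤ e := by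
  rw [inv_eq_conj hc] at h
  simpa using (Complex.abs_im_le_norm _).trans h

/-- Adding the imaginary parts of the two differences cancels `Im z`. -/
lemma abs_im_le_of_conj {c z : ℂ} (hc : ‖c‖ = 1) {e : ℝ} (h : ‖z - c⁻¹‖ ≤ e)
    (h' : ‖conj z - c⁻¹‖ ≤ e) : |c.im| ≤ e := by
  rw [inv_eq_conj hc] at h h'
  have h1 := (Complex.abs_im_le_norm _).trans h
  have h2 := (Complex.abs_im_le_norm _).trans h'
  simp at h1 h2
  rw [abs_le] at *
  constructor <;> linarith

/-- `a + e^{iθ} b` is bounded below for `a, b ≥ 0`. -/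
lemma cos_half_mul_le (θ : ℝ) (a b : ℝ) :
    Real.cos (θ / 2) * (a + b) ≤ ‖(a : ℂ) + Complex.exp (θ * Complex.I) * b‖ := by
  -- Rotation by `-θ/2` puts the two directions at angles `±θ/2`, both with real part `cos (θ/2)`.
  have e : ((a : ℂ) + Complex.exp (θ * Complex.I) * b) * Complex.exp ((-(θ / 2) : ℝ) * Complex.I) =
      a * Complex.exp ((-(θ / 2) : ℝ) * Complex.I) + b * Complex.exp ((θ / 2 : ℝ) * Complex.I) := by
    have : Complex.exp (θ * Complex.I) * Complex.exp ((-(θ / 2) : ℝ) * Complex.I) =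
        Complex.exp ((θ / 2 : ℝ) * Complex.I) := by
      rw [← Complex.exp_add]
      congr 1
      push_cast
      ring
    rw [← this]
    ring
  have h := Complex.re_le_norm (((a : ℂ) + Complex.exp (θ * Complex.I) * b) *
    Complex.exp ((-(θ / 2) : ℝ) * Complex.I))
  rw [norm_mul, Complex.norm_exp_ofReal_mul_I, mul_one, e, Complex.add_re, Complex.re_ofReal_mul,
    Complex.re_ofReal_mul, Complex.exp_ofReal_mul_I_re, Complex.exp_ofReal_mul_I_re,
    Real.cos_neg] at h
  linarith

/-- Eliminating `w` gives `(1 - τ ^ 2) ‖z‖ ≤ (1 + τ) e`. The off-diagonal entries of `P* [0 1; τ 0]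
P` form such a pair; each diagonal one pairs with itself. -/
lemma norm_le_of_twisted {τ e : ℝ} (h0 : 0 ≤ τ) (h1 : τ < 1) {z w : ℂ} (hz : ‖z + τ * conj w‖ ≤ e)
    (hw : ‖w + τ * conj z‖ ≤ e) : ‖z‖ ≤ 1 / (1 - τ) * e := by
  have e1 : ((1 - τ ^ 2 : ℝ) : ℂ) * z = (z + τ * conj w) - τ * conj (w + τ * conj z) := by
    simp only [map_add, map_mul, Complex.conj_conj, Complex.conj_ofReal]
    push_cast
    ring
  have h2 : (1 - τ ^ 2) * ‖z‖ ≤ e + τ * e := by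
    rw [← abs_of_pos (by nlinarith : 0 < 1 - τ ^ 2), ← Real.norm_eq_abs, ← Complex.norm_real,
      ← norm_mul, e1]
    refine (norm_sub_le _ _).trans (add_le_add hz ?_)
    rw [norm_mul, Complex.norm_conj, Complex.norm_real, Real.norm_of_nonneg h0]
    exact mul_le_mul_of_nonneg_left hw h0
  rw [div_mul_eq_mul_div, one_mul, le_div_iff₀ (by linarith)]
  have h3 : (1 + τ) * (‖z‖ * (1 - τ)) ≤ (1 + τ) * e := by linarith
  exact le_of_mul_le_mul_left h3 (by linarith)

/-! ### The lines of the table -/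

/-- The conclusion of the necessary condition for a line of the table. -/
def NecessaryBound (B A : Mat2) (F : Exprs) : Prop :=
  ∃ ν : ℝ, 0 < ν ∧ ∀ (c : Circle) (P : GL (Fin 2) ℂ), Small B A c P →
    ∃ k : ℤ, BoundedBy F c P k (ν * ‖pert B A c P‖)

lemma norm_le_one_of_eq {α : ℂ} (h : α = 0 ∨ α = 1) : ‖α‖ ≤ 1 := by
  rcases h with rfl | rfl <;> simp

lemma cos_half_pos {θ : ℝ} (h0 : 0 ≤ θ) (h1 : θ < Real.pi) : 0 < Real.cos (θ / 2) :=
  Real.cos_pos_of_mem_Ioo ⟨by linarith [Real.pi_pos], by linarith⟩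

lemma anti_entry_eq (τ : ℝ) (z : ℂ) :
    (1 + τ) * (z.re : ℂ) + Complex.I * (1 - τ) * (z.im : ℂ) = z + τ * conj z := by
  apply Complex.ext <;> simp <;> ring

lemma two_mul_re (z : ℂ) : 2 * (z.re : ℂ) = z + conj z := by
  apply Complex.ext <;> simp
  ring

lemma necessaryBound_conv_diagTheta (α : ℂ) {θ : ℝ} (h0 : 0 ≤ θ) (h1 : θ < Real.pi) :
    NecessaryBound !![α, 0; 0, 0] !![1, 0; 0, Complex.exp (θ * Complex.I)]
      (fun c x y u v _ =>
        [(‖x‖ : ℂ) ^ 2 + Complex.exp (θ * Complex.I) * (‖u‖ : ℂ) ^ 2 - c⁻¹ * α, y ^ 2, v ^ 2]) := by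
  have hκ := cos_half_pos h0 h1
  refine exists_bound (1 + 1 / Real.cos (θ / 2)) (by positivity) ?_
  rintro c x y u v e hc he ⟨h1, h2, h3, h4⟩
  refine ⟨0, ?_⟩
  have h5 : Real.cos (θ / 2) * (‖y‖ ^ 2 + ‖v‖ ^ 2) ≤ e := by
    refine (cos_half_mul_le θ _ _).trans (le_trans (le_of_eq ?_) h4)
    push_cast
    rw [← Complex.mul_conj', ← Complex.mul_conj']
    congr 1
    ring
  have h6 : ‖y‖ ^ 2 + ‖v‖ ^ 2 ≤ 1 / Real.cos (θ / 2) * e := by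
    rw [div_mul_eq_mul_div, one_mul, le_div_iff₀ hκ]
    linarith
  have hκe : 0 ≤ 1 / Real.cos (θ / 2) * e := by positivity
  simp only [List.forall_mem_cons, List.not_mem_nil, false_imp_iff, implies_true, and_true, norm_pow]
  refine ⟨?_, by nlinarith [sq_nonneg ‖v‖], by nlinarith [sq_nonneg ‖y‖]⟩
  have e1 : (‖x‖ : ℂ) ^ 2 + Complex.exp (θ * Complex.I) * (‖u‖ : ℂ) ^ 2 - c⁻¹ * α =
      conj x * (1 * x + 0 * u) + conj u * (0 * x + Complex.exp (θ * Complex.I) * u) - c⁻¹ * α := by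
    rw [← Complex.mul_conj', ← Complex.mul_conj']
    ring
  rw [e1]
  linarith

lemma necessaryBound_conv_antiTau (α : ℂ) {τ : ℝ} (h0 : 0 ≤ τ) (h1 : τ < 1) :
    NecessaryBound !![α, 0; 0, 0] !![0, 1; (τ : ℂ), 0]
      (fun c x y u v _ =>
        [conj y * v, conj x * v, conj u * y,
          (1 + τ) * ((conj x * u).re : ℂ) + Complex.I * (1 - τ) * ((conj x * u).im : ℂ)
            - α / c]) := by
  have hτ : 0 < 1 - τ := by linarith
  refine exists_bound (1 / (1 - τ)) (by positivity) ?_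
  rintro c x y u v e hc he ⟨h00, h01, h10, h11⟩
  refine ⟨0, ?_⟩
  simp only [List.forall_mem_cons, List.not_mem_nil, false_imp_iff, implies_true, and_true]
  have k11 : ‖conj y * v + τ * conj (conj y * v)‖ ≤ e := by
    convert h11 using 2
    simp
    ring
  have k01 : ‖conj x * v + τ * conj (conj y * u)‖ ≤ e := by
    convert h01 using 2
    simp
    ring
  have k10 : ‖conj y * u + τ * conj (conj x * v)‖ ≤ e := by
    convert h10 using 2
    simp
    ring
  refine ⟨norm_le_of_twisted h0 h1 k11 k11, norm_le_of_twisted h0 h1 k01 k10, ?_, ?_⟩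
  · have := norm_le_of_twisted h0 h1 k10 k01
    rw [← Complex.norm_conj]
    convert this using 2
    simp
    ring
  · have h2 : e ≤ 1 / (1 - τ) * e := by
      rw [div_mul_eq_mul_div, one_mul, le_div_iff₀ hτ]
      nlinarith
    refine le_trans (le_of_eq ?_) (h00.trans h2)
    rw [anti_entry_eq]
    congr 1
    simp
    ring

lemma necessaryBound_conv_antiI (α : ℂ) :
    NecessaryBound !![α, 0; 0, 0] !![0, 1; 1, Complex.I]
      (fun c x y u v _ =>
        [conj x * v + conj u * y, conj u * v, ((conj y * v).re : ℂ), v ^ 2,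
          2 * ((conj x * u).re : ℂ) + Complex.I * (‖u‖ : ℂ) ^ 2 - α / c]) := by
  refine exists_bound 1 one_pos ?_
  rintro c x y u v e hc he ⟨h00, h01, h10, h11⟩
  refine ⟨0, ?_⟩
  simp only [List.forall_mem_cons, List.not_mem_nil, false_imp_iff, implies_true, and_true, one_mul]
  have k01 : ‖(conj x * v + conj u * y) + Complex.I * (conj u * v)‖ ≤ e := by
    convert h01 using 2
    ring
  have k10 : ‖(conj x * v + conj u * y) - Complex.I * (conj u * v)‖ ≤ e := by
    rw [← Complex.norm_conj]
    convert h10 using 2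
    simp
    ring
  have k11 : ‖2 * ((conj y * v).re : ℂ) + Complex.I * (‖v‖ : ℂ) ^ 2‖ ≤ e := by
    convert h11 using 2
    rw [two_mul_re, ← Complex.mul_conj']
    simp
    ring
  refine ⟨?_, ?_, ?_, ?_, ?_⟩
  · have e1 : (2 : ℂ) * (conj x * v + conj u * y) =
      ((conj x * v + conj u * y) + Complex.I * (conj u * v)) +
      ((conj x * v + conj u * y) - Complex.I * (conj u * v)) := by ring
    have := norm_add_le_of_le k01 k10
    rw [← e1, norm_mul, Complex.norm_two] at this
    linarith
  · have e1 : (2 * Complex.I : ℂ) * (conj u * v) =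
      ((conj x * v + conj u * y) + Complex.I * (conj u * v)) -
      ((conj x * v + conj u * y) - Complex.I * (conj u * v)) := by ring
    have := norm_sub_le_of_le k01 k10
    rw [← e1, norm_mul, norm_mul, Complex.norm_two, Complex.norm_I] at this
    linarith
  · have := (Complex.abs_re_le_norm _).trans k11
    simp [← Complex.ofReal_pow] at this
    rw [Complex.norm_real, Real.norm_eq_abs]
    simp
    linarith
  · have := (Complex.abs_im_le_norm _).trans k11
    simp [← Complex.ofReal_pow] at this
    simpa using this
  · refine le_trans (le_of_eq ?_) h00
    rw [two_mul_re, ← Complex.mul_conj']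
    congr 1
    simp
    ring

lemma necessaryBound_conv_swap {α β ω : ℂ}
    (h : (α = 0 ∧ ω = 0 ∧ β = 1) ∨
      (β = 0 ∧ (α = 0 ∨ α = 1) ∧ (ω = 0 ∨ ω = α ∨ ω = -α))) :
    NecessaryBound !![α, β; β, ω] swap
      (fun _ x y u v k =>
        [2 * ((conj y * v).re : ℂ) - (-1) ^ k * ω, 2 * ((conj x * u).re : ℂ) - (-1) ^ k * α,
          (conj x * v + conj u * y) - (-1) ^ k * β]) := by
  refine exists_bound 3 (by norm_num) ?_
  rintro c x y u v e hc he ⟨h00, h01, h10, h11⟩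
  replace h00 : ‖2 * ((conj x * u).re : ℂ) - c⁻¹ * α‖ ≤ e := by
    convert h00 using 2
    rw [two_mul_re]
    simp
    ring
  replace h11 : ‖2 * ((conj y * v).re : ℂ) - c⁻¹ * ω‖ ≤ e := by
    convert h11 using 2
    rw [two_mul_re]
    simp
    ring
  replace h01 : ‖(conj x * v + conj u * y) - c⁻¹ * β‖ ≤ e := by
    convert h01 using 2
    ring
  replace h10 : ‖conj (conj x * v + conj u * y) - c⁻¹ * β‖ ≤ e := by
    convert h10 using 2
    simp
    ring
  have key : (α = 0 ∧ β = 0 ∧ ω = 0) ∨ |c.im| ≤ e := by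
    rcases h with ⟨rfl, rfl, rfl⟩ | ⟨rfl, rfl | rfl, hω⟩
    · right
      rw [mul_one] at h01 h10
      exact abs_im_le_of_conj hc h01 h10
    · left
      simpa using hω
    · right
      rw [mul_one] at h00
      exact abs_im_le_of_real (r := 2 * (conj x * u).re) hc (by push_cast; exact h00)
  have hα : ‖α‖ ≤ 1 := by rcases h with ⟨rfl, rfl, rfl⟩ | ⟨rfl, rfl | rfl, hω⟩ <;> simp
  have hβ : ‖β‖ ≤ 1 := by rcases h with ⟨rfl, rfl, rfl⟩ | ⟨rfl, rfl | rfl, hω⟩ <;> simp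
  have hω : ‖ω‖ ≤ 1 := by
    rcases h with ⟨-, rfl, -⟩ | ⟨-, -, rfl | rfl | rfl⟩
    · simp
    · simp
    · exact hα
    · rwa [norm_neg]
  rcases key with ⟨rfl, rfl, rfl⟩ | key
  · refine ⟨0, ?_⟩
    simp only [List.forall_mem_cons, List.not_mem_nil, false_imp_iff, implies_true, and_true]
    simp only [mul_zero] at *
    exact ⟨by linarith, by linarith, by linarith⟩
  · obtain ⟨k, hk⟩ := exists_sign hc
    refine ⟨k, ?_⟩
    simp only [List.forall_mem_cons, List.not_mem_nil, false_imp_iff, implies_true, and_true]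
    refine ⟨?_, ?_, ?_⟩
    · linarith [norm_sub_sign_mul_le hc h11 hω hk]
    · linarith [norm_sub_sign_mul_le hc h00 hα hk]
    · linarith [norm_sub_sign_mul_le hc h01 hβ hk]

/-- Real form of the estimate for `1 ⊕ e^{iθ}`: `C + i S = e^{iθ}` and `p + i q = c`. -/
lemma sector_bounds {S C p q X Y U V e : ℝ} (hS : 0 < S) (hC : |C| ≤ 1) (hn : p ^ 2 + q ^ 2 = 1)
    (hX : 0 ≤ X) (hY : 0 ≤ Y) (hU : 0 ≤ U) (he : 0 ≤ e)
    (a1 : |X + C * U - p| ≤ e) (a2 : |S * U + q| ≤ e) (a3 : |C * Y + V - p| ≤ e)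
    (a4 : |-(S * Y) + q| ≤ e) :
    U ≤ (5 + 6 / S) * e ∧ Y ≤ (5 + 6 / S) * e ∧ |X - 1| ≤ (5 + 6 / S) * e ∧
      |V - 1| ≤ (5 + 6 / S) * e := by
  rw [abs_le] at a1 a2 a3 a4
  have hSU := mul_nonneg hS.le hU
  have hSY := mul_nonneg hS.le hY
  -- The imaginary parts squeeze `q` from both sides: `S Y - e ≤ q ≤ e - S U`.
  have hU2 : U ≤ 2 / S * e := by
    rw [div_mul_eq_mul_div, le_div_iff₀ hS]; linarith
  have hY2 : Y ≤ 2 / S * e := by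
    rw [div_mul_eq_mul_div, le_div_iff₀ hS]; linarith
  have hq : |q| ≤ e := abs_le.2 ⟨by linarith, by linarith⟩
  have hK3 : 6 / S * e = 3 * (2 / S * e) := by ring
  rw [add_mul, hK3]
  generalize 2 / S * e = K at *
  have hCU : |C * U| ≤ K := by
    rw [abs_mul, abs_of_nonneg hU]
    exact (mul_le_of_le_one_left hU hC).trans hU2
  have hCY : |C * Y| ≤ K := by
    rw [abs_mul, abs_of_nonneg hY]
    exact (mul_le_of_le_one_left hY hC).trans hY2
  rw [abs_le] at hCU hCY
  have hp1 : p ≤ 1 := by nlinarith only [hn, sq_nonneg q]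
  have hq1 : |q| ≤ 1 := by
    rw [← sq_le_one_iff_abs_le_one]
    linarith [sq_nonneg p]
  have hq2 : q ^ 2 ≤ |q| := by
    rw [← sq_abs]
    nlinarith only [abs_nonneg q, hq1]
  -- If `p ≥ 0`, then `1 - p ≤ q ^ 2 ≤ e`. If `p ≤ 0`, then `X ≥ 0` gives `-p ≤ e + K`, and `1 ≤ -p
  -- + q ^ 2` forces `e` or `K` to be large.
  have hp : 1 - p ≤ 4 * e + 2 * K := by
    rcases le_total 0 p with hp0 | hp0
    · have : p ^ 2 ≤ p := by nlinarith only [hp0, hp1]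
      linarith
    · have h3 : p ^ 2 ≤ -p := by
        have : -1 ≤ p := by nlinarith only [hn, sq_nonneg q]
        nlinarith only [hp0, this]
      linarith
  refine ⟨by linarith, by linarith, ?_, ?_⟩ <;> rw [abs_le] <;> constructor <;> linarith

lemma necessaryBound_diagTheta_self {θ : ℝ} (h0 : 0 < θ) (h1 : θ < Real.pi) :
    NecessaryBound !![1, 0; 0, Complex.exp (θ * Complex.I)]
      !![1, 0; 0, Complex.exp (θ * Complex.I)]
      (fun _ x y u v _ => [u ^ 2, y ^ 2, (‖x‖ : ℂ) ^ 2 - 1, (‖v‖ : ℂ) ^ 2 - 1]) := by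
  have hS := Real.sin_pos_of_pos_of_lt_pi h0 h1
  have hre := Complex.exp_ofReal_mul_I_re θ
  have him := Complex.exp_ofReal_mul_I_im θ
  have hw : ‖Complex.exp (θ * Complex.I)‖ = 1 := Complex.norm_exp_ofReal_mul_I θ
  have hCabs := Real.abs_cos_le_one θ
  have hwc : Complex.exp (θ * Complex.I) * conj (Complex.exp (θ * Complex.I)) = 1 := by
    rw [Complex.mul_conj', hw]; simp
  generalize Complex.exp (θ * Complex.I) = w at *
  generalize Real.sin θ = S at *
  generalize Real.cos θ = C at *
  refine exists_bound (5 + 6 / S) (by positivity) ?_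
  rintro c x y u v e hc he ⟨h00, h01, h10, h11⟩
  refine ⟨0, ?_⟩
  simp only [List.forall_mem_cons, List.not_mem_nil, false_imp_iff, implies_true, and_true, norm_pow]
  replace h00 : ‖((‖x‖ ^ 2 : ℝ) : ℂ) + w * ((‖u‖ ^ 2 : ℝ) : ℂ) - conj c‖ ≤ e := by
    convert h00 using 2
    push_cast
    rw [← Complex.mul_conj', ← Complex.mul_conj', inv_eq_conj hc]
    ring
  -- Multiplying by `conj w` gives this entry the target `conj c` as well, with `‖y‖ ^ 2` now on the
  -- conjugate ray.
  replace h11 : ‖conj w * ((‖y‖ ^ 2 : ℝ) : ℂ) + ((‖v‖ ^ 2 : ℝ) : ℂ) - conj c‖ ≤ e := by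
    rw [← one_mul ‖_‖, ← hw, ← norm_mul]
    convert h11 using 2
    push_cast
    rw [← Complex.mul_conj', ← Complex.mul_conj', inv_eq_conj hc]
    linear_combination y * conj y * hwc
  have a1 := (Complex.abs_re_le_norm _).trans h00
  have a2 := (Complex.abs_im_le_norm _).trans h00
  have a3 := (Complex.abs_re_le_norm _).trans h11
  have a4 := (Complex.abs_im_le_norm _).trans h11
  simp only [Complex.add_re, Complex.add_im, Complex.sub_re, Complex.sub_im, Complex.ofReal_re,
    Complex.ofReal_im, Complex.re_mul_ofReal, Complex.im_mul_ofReal, Complex.conj_re,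
    Complex.conj_im, hre, him] at a1 a2 a3 a4
  have hn := re_sq_add_im_sq hc
  have hx := sq_nonneg ‖x‖
  have hy := sq_nonneg ‖y‖
  have hu := sq_nonneg ‖u‖
  have e1 : ((‖x‖ : ℂ) ^ 2 - 1) = ((‖x‖ ^ 2 - 1 : ℝ) : ℂ) := by push_cast; rfl
  have e2 : ((‖v‖ : ℂ) ^ 2 - 1) = ((‖v‖ ^ 2 - 1 : ℝ) : ℂ) := by push_cast; rfl
  rw [e1, e2, Complex.norm_real, Complex.norm_real, Real.norm_eq_abs, Real.norm_eq_abs]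
  exact sector_bounds hS hCabs hn hx hy hu he
    (by simpa using a1) (by simpa using a2) (by simpa using a3) (by simpa using a4)

lemma necessaryBound_antiTau_self {τ : ℝ} (h0 : 0 ≤ τ) (h1 : τ < 1) :
    NecessaryBound !![0, 1; (τ : ℂ), 0] !![0, 1; (τ : ℂ), 0]
      (fun c x y u v _ => [conj x * u, conj y * v, conj y * u, conj x * v - c⁻¹]) := by
  have hτ : 0 < 1 - τ := by linarith
  refine exists_bound (1 / (1 - τ) * 25) (by positivity) ?_
  intro c x y u v e hc he h
  have hτn : ‖(τ : ℂ)‖ ≤ 1 := by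
    rw [Complex.norm_real, Real.norm_of_nonneg h0]
    exact h1.le
  have him := mul_abs_im_le hc h (by simp) (by simp) hτn (by simp) h0 h1.le (by ring) (by ring)
  obtain ⟨h00, h01, h10, h11⟩ := h
  refine ⟨0, ?_⟩
  simp only [List.forall_mem_cons, List.not_mem_nil, false_imp_iff, implies_true, and_true]
  have k00 : ‖conj x * u + τ * conj (conj x * u)‖ ≤ 25 * e := by
    refine le_trans (le_of_eq ?_) (h00.trans (by linarith : e ≤ 25 * e))
    congr 1
    simp
    ring
  have k11 : ‖conj y * v + τ * conj (conj y * v)‖ ≤ 25 * e := by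
    refine le_trans (le_of_eq ?_) (h11.trans (by linarith : e ≤ 25 * e))
    congr 1
    simp
    ring
  have k01 : ‖(conj x * v - c⁻¹) + τ * conj (conj y * u)‖ ≤ 25 * e := by
    refine le_trans (le_of_eq ?_) (h01.trans (by linarith : e ≤ 25 * e))
    congr 1
    simp
    ring
  -- The target of this entry is `c⁻¹ τ`, but the twisted pair needs `conj c⁻¹ τ`. The discrepancy
  -- `2 τ |Im c|` is at most `24 e` by the determinant argument, whence `25`.
  have k10 : ‖conj y * u + τ * conj (conj x * v - c⁻¹)‖ ≤ 25 * e := by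
    have e1 : conj y * u + τ * conj (conj x * v - c⁻¹) =
        (conj y * (0 * x + 1 * u) + conj v * (τ * x + 0 * u) - c⁻¹ * τ) +
          τ * ((-2 * c.im : ℝ) * Complex.I) := by
      have e2 : ((-2 * c.im : ℝ) : ℂ) * Complex.I = conj c - c := by
        apply Complex.ext <;> simp
        ring
      rw [e2, inv_eq_conj hc]
      simp
      ring
    rw [e1]
    refine (norm_add_le_of_le h10 le_rfl).trans ?_
    rw [norm_mul, norm_mul, Complex.norm_I, Complex.norm_real, Complex.norm_real,
      Real.norm_of_nonneg h0, Real.norm_eq_abs, abs_mul]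
    norm_num
    linarith
  have h2 : ∀ r, 1 / (1 - τ) * 25 * r = 1 / (1 - τ) * (25 * r) := fun r => by ring
  rw [h2]
  exact ⟨norm_le_of_twisted h0 h1 k00 k00, norm_le_of_twisted h0 h1 k11 k11,
    norm_le_of_twisted h0 h1 k10 k01, norm_le_of_twisted h0 h1 k01 k10⟩

lemma necessaryBound_antiTau_self_c {τ : ℝ} (h0 : 0 < τ) (h1 : τ < 1) :
    NecessaryBound !![0, 1; (τ : ℂ), 0] !![0, 1; (τ : ℂ), 0]
      (fun c _ _ _ _ k => [c - (-1) ^ k]) := by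
  refine exists_bound (24 / τ) (by positivity) ?_
  intro c x y u v e hc he h
  have hτn : ‖(τ : ℂ)‖ ≤ 1 := by
    rw [Complex.norm_real, Real.norm_of_nonneg h0.le]
    exact h1.le
  have him := mul_abs_im_le hc h (by simp) (by simp) hτn (by simp) h0.le h1.le (by ring) (by ring)
  obtain ⟨k, hk⟩ := exists_sign hc
  refine ⟨k, ?_⟩
  simp only [List.forall_mem_cons, List.not_mem_nil, false_imp_iff, implies_true, and_true]
  refine hk.trans ?_
  rw [div_mul_eq_mul_div, le_div_iff₀ h0]
  linarith

lemma necessaryBound_antiI_sym {α β ω : ℂ}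
    (h : (β = 1 ∧ α = 0 ∧ (ω = 0 ∨ ω = Complex.I)) ∨ (β = 0 ∧ -ω = α ∧ (α = 0 ∨ α = 1))) :
    NecessaryBound !![α, β; β, ω] !![0, 1; 1, Complex.I]
      (fun _ x y u v k =>
        [2 * ((conj x * u).re : ℂ) - (-1) ^ k * α,
          2 * ((conj y * v).re : ℂ) - (-1) ^ k * (ω.re : ℂ),
          conj x * v + conj u * y - (-1) ^ k * β, u ^ 2,
          (‖v‖ : ℂ) ^ 2 - (-1) ^ k * (ω.im : ℂ)]) := by
  refine exists_bound 25 (by norm_num) ?_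
  intro c x y u v e hc he hE
  have hα : ‖α‖ ≤ 1 := by
    rcases h with ⟨-, rfl, -⟩ | ⟨-, -, hα⟩
    · simp
    · exact norm_le_one_of_eq hα
  have hβ : ‖β‖ ≤ 1 := by rcases h with ⟨rfl, -⟩ | ⟨rfl, -⟩ <;> simp
  have hω : ‖ω‖ ≤ 1 := by
    rcases h with ⟨-, -, rfl | rfl⟩ | ⟨-, h, -⟩
    · simp
    · simp
    · rw [← norm_neg, h]; exact hα
  have hαr : α = (α.re : ℂ) := by
    rcases h with ⟨-, rfl, -⟩ | ⟨-, -, rfl | rfl⟩ <;> simp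
  have hβr : conj β = β := by rcases h with ⟨rfl, -⟩ | ⟨rfl, -⟩ <;> simp
  obtain ⟨k, h00, h01, h10, h11⟩ : ∃ k : ℤ,
      ‖conj x * (0 * x + 1 * u) + conj u * (1 * x + Complex.I * u) - (-1) ^ k * α‖ ≤ 25 * e ∧
      ‖conj x * (0 * y + 1 * v) + conj u * (1 * y + Complex.I * v) - (-1) ^ k * β‖ ≤ 25 * e ∧
      ‖conj y * (0 * x + 1 * u) + conj v * (1 * x + Complex.I * u) - (-1) ^ k * β‖ ≤ 25 * e ∧
      ‖conj y * (0 * y + 1 * v) + conj v * (1 * y + Complex.I * v) - (-1) ^ k * ω‖ ≤ 25 * e := by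
    -- Either the target is zero and the sign is irrelevant, or both determinants equal `-1` and `c`
    -- is near a sign.
    have hdet : (α = 0 ∧ β = 0 ∧ ω = 0) ∨ α * ω - β * β = -(1 : ℝ) := by
      rcases h with ⟨rfl, rfl, -⟩ | ⟨rfl, hω, rfl | rfl⟩
      · right; simp
      · left; simpa using hω
      · right
        rw [neg_eq_iff_eq_neg.1 hω]
        simp
    rcases hdet with ⟨rfl, rfl, rfl⟩ | hdet
    · obtain ⟨h00, h01, h10, h11⟩ := hE
      simp only [mul_zero] at *
      exact ⟨0, by linarith, by linarith, by linarith, by linarith⟩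
    · have him := mul_abs_im_le hc hE hα hβ hβ hω zero_le_one le_rfl (by simp) hdet
      obtain ⟨h00, h01, h10, h11⟩ := hE
      obtain ⟨k, hk⟩ := exists_sign hc
      replace hk : ‖c - (-1) ^ k‖ ≤ 24 * e := by linarith
      refine ⟨k, ?_, ?_, ?_, ?_⟩
      · linarith [norm_sub_sign_mul_le hc h00 hα hk]
      · linarith [norm_sub_sign_mul_le hc h01 hβ hk]
      · linarith [norm_sub_sign_mul_le hc h10 hβ hk]
      · linarith [norm_sub_sign_mul_le hc h11 hω hk]
  refine ⟨k, ?_⟩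
  simp only [List.forall_mem_cons, List.not_mem_nil, false_imp_iff, implies_true, and_true]
  obtain ⟨s, hs⟩ : ∃ s : ℝ, (-1 : ℂ) ^ k = s := ⟨(-1) ^ k, by push_cast; rfl⟩
  rw [hs] at h00 h01 h10 h11 ⊢
  have k00 : ‖((2 * (conj x * u).re - s * α.re : ℝ) : ℂ) + ((‖u‖ ^ 2 : ℝ) : ℂ) * Complex.I‖ ≤
      25 * e := by
    convert h00 using 2
    push_cast
    rw [two_mul_re, ← Complex.mul_conj', ← hαr]
    simp
    ring
  have k11 : ‖((2 * (conj y * v).re - s * ω.re : ℝ) : ℂ) +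
      ((‖v‖ ^ 2 - s * ω.im : ℝ) : ℂ) * Complex.I‖ ≤ 25 * e := by
    convert h11 using 2
    push_cast
    rw [two_mul_re, ← Complex.mul_conj']
    simp
    linear_combination (-s : ℂ) * Complex.re_add_im ω
  have k10 : ‖(conj x * v + conj u * y - s * β) - Complex.I * (conj u * v)‖ ≤ 25 * e := by
    rw [← Complex.norm_conj]
    convert h10 using 2
    simp [hβr]
    ring
  have a00 := (Complex.abs_re_le_norm _).trans k00
  have b00 := (Complex.abs_im_le_norm _).trans k00
  have a11 := (Complex.abs_re_le_norm _).trans k11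
  have b11 := (Complex.abs_im_le_norm _).trans k11
  simp only [Complex.add_re, Complex.add_im, Complex.re_ofReal_mul, Complex.im_ofReal_mul,
    Complex.I_re, Complex.I_im, mul_zero, mul_one, add_zero, zero_add, Complex.ofReal_re,
    Complex.ofReal_im] at a00 b00 a11 b11
  refine ⟨?_, ?_, ?_, ?_, ?_⟩
  · rw [hαr]
    rw [← Real.norm_eq_abs, ← Complex.norm_real] at a00
    simpa using a00
  · rw [← Real.norm_eq_abs, ← Complex.norm_real] at a11
    simpa using a11
  -- Adding one off-diagonal entry to the conjugate of the other cancels `i conj u v`.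
  · have e1 : (2 : ℂ) * (conj x * v + conj u * y - s * β) =
      (conj x * (0 * y + 1 * v) + conj u * (1 * y + Complex.I * v) - s * β) +
      ((conj x * v + conj u * y - s * β) - Complex.I * (conj u * v)) := by ring
    have := norm_add_le_of_le h01 k10
    rw [← e1, norm_mul, Complex.norm_two] at this
    linarith
  · rw [norm_pow]
    exact (le_abs_self _).trans b00
  · rw [← Real.norm_eq_abs, ← Complex.norm_real] at b11
    simpa using b11

lemma necessaryBound_diagSign (α ω σ : ℂ) :
    NecessaryBound !![α, 0; 0, ω] !![1, 0; 0, σ]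
      (fun c x y u v _ =>
        [((‖x‖ : ℂ) ^ 2 + σ * (‖u‖ : ℂ) ^ 2) - c⁻¹ * α, conj x * y + σ * (conj u * v),
          ((‖y‖ : ℂ) ^ 2 + σ * (‖v‖ : ℂ) ^ 2) - c⁻¹ * ω]) := by
  refine exists_bound 1 one_pos ?_
  rintro c x y u v e hc he ⟨h00, h01, h10, h11⟩
  refine ⟨0, ?_⟩
  simp only [List.forall_mem_cons, List.not_mem_nil, false_imp_iff, implies_true, and_true, one_mul]
  refine ⟨le_trans (le_of_eq ?_) h00, le_trans (le_of_eq ?_) h01, le_trans (le_of_eq ?_) h11⟩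
  · rw [← Complex.mul_conj', ← Complex.mul_conj']
    congr 1
    ring
  · congr 1
    ring
  · rw [← Complex.mul_conj', ← Complex.mul_conj']
    congr 1
    ring

lemma necessaryBound_diagOne_self_c :
    NecessaryBound !![1, 0; 0, 1] !![1, 0; 0, 1] (fun c _ _ _ _ _ => [c - 1]) := by
  refine exists_bound 4 (by norm_num) ?_
  rintro c x y u v e hc he ⟨h00, h01, h10, h11⟩
  refine ⟨0, ?_⟩
  simp only [List.forall_mem_cons, List.not_mem_nil, false_imp_iff, implies_true, and_true]
  refine norm_sub_one_le_of_nonneg (r := ‖x‖ ^ 2 + ‖u‖ ^ 2) hc (by positivity) ?_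
  convert h00 using 2
  push_cast
  rw [← Complex.mul_conj', ← Complex.mul_conj']
  ring

lemma necessaryBound_diagNeg_self_c :
    NecessaryBound !![1, 0; 0, -1] !![1, 0; 0, -1] (fun c _ _ _ _ k => [c - (-1) ^ k]) := by
  refine exists_bound 2 (by norm_num) ?_
  rintro c x y u v e hc he ⟨h00, h01, h10, h11⟩
  obtain ⟨k, hk⟩ := exists_sign hc
  refine ⟨k, ?_⟩
  simp only [List.forall_mem_cons, List.not_mem_nil, false_imp_iff, implies_true, and_true]
  have : |c.im| ≤ e := by
    refine abs_im_le_of_real (r := ‖x‖ ^ 2 - ‖u‖ ^ 2) hc ?_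
    convert h00 using 2
    push_cast
    rw [← Complex.mul_conj', ← Complex.mul_conj']
    ring
  linarith

lemma necessaryBound_rankOne {α : ℂ} (hα : α = 0 ∨ α = 1) :
    NecessaryBound !![α, 0; 0, 0] !![1, 0; 0, 0]
      (fun _ x y _ _ _ => [y ^ 2, (‖x‖ : ℂ) ^ 2 - α]) := by
  refine exists_bound 1 one_pos ?_
  rintro c x y u v e hc he ⟨h00, h01, h10, h11⟩
  refine ⟨0, ?_⟩
  simp only [List.forall_mem_cons, List.not_mem_nil, false_imp_iff, implies_true, and_true, one_mul]
  constructor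
  · simpa [sq] using h11
  -- Comparing moduli through the reverse triangle inequality removes `c`.
  · have e1 : ((‖x‖ : ℂ) ^ 2 - α) = ((‖((‖x‖ ^ 2 : ℝ) : ℂ)‖ - ‖c⁻¹ * α‖ : ℝ) : ℂ) := by
      have : ‖α‖ = α.re := by rcases hα with rfl | rfl <;> simp
      have h2 : ((α.re : ℝ) : ℂ) = α := by rcases hα with rfl | rfl <;> simp
      rw [norm_mul, norm_inv, hc, this, Complex.norm_real, Real.norm_of_nonneg (by positivity)]
      push_cast
      rw [h2]
      simp
    rw [e1, Complex.norm_real, Real.norm_eq_abs]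
    refine (abs_norm_sub_norm_le _ _).trans (le_trans (le_of_eq ?_) h00)
    push_cast
    rw [← Complex.mul_conj']
    congr 1
    ring

lemma necessaryBound_swap_diagNeg :
    NecessaryBound swap !![1, 0; 0, -1]
      (fun _ x y u v k =>
        [conj x * y - conj u * v - (-1) ^ k, (‖x‖ : ℂ) ^ 2 - (‖u‖ : ℂ) ^ 2,
          (‖y‖ : ℂ) ^ 2 - (‖v‖ : ℂ) ^ 2]) := by
  refine exists_bound 3 (by norm_num) ?_
  rintro c x y u v e hc he ⟨h00, h01, h10, h11⟩
  obtain ⟨k, hk⟩ := exists_sign hc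
  refine ⟨k, ?_⟩
  simp only [List.forall_mem_cons, List.not_mem_nil, false_imp_iff, implies_true, and_true]
  replace h01 : ‖conj x * y - conj u * v - c⁻¹ * 1‖ ≤ e := by
    convert h01 using 2
    ring
  replace h10 : ‖conj (conj x * y - conj u * v) - c⁻¹ * 1‖ ≤ e := by
    convert h10 using 2
    simp
    ring
  have him : |c.im| ≤ e := abs_im_le_of_conj hc (by simpa using h01) (by simpa using h10)
  refine ⟨?_, ?_, ?_⟩
  · have := norm_sub_sign_mul_le hc h01 (by simp) hk
    rw [mul_one] at this
    linarith
  · refine le_trans (le_of_eq ?_) (h00.trans (by linarith))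
    rw [← Complex.mul_conj', ← Complex.mul_conj']
    congr 1
    ring
  · refine le_trans (le_of_eq ?_) (h11.trans (by linarith))
    rw [← Complex.mul_conj', ← Complex.mul_conj']
    congr 1
    ring

lemma Line.necessaryBound {B A : Mat2} {F : Exprs} (h : Line B A F) : NecessaryBound B A F := by
  cases h with
  | ofConv h =>
    cases h with
    | diagTheta α θ hα h0 h1 => exact necessaryBound_conv_diagTheta α h0 h1
    | antiTau α τ hα h0 h1 => exact necessaryBound_conv_antiTau α h0 h1
    | swap α β ω h => exact necessaryBound_conv_swap h
    | antiI α hα => exact necessaryBound_conv_antiI α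
  | diagTheta_self θ h0 h1 => exact necessaryBound_diagTheta_self h0 h1
  | antiI_sym α β ω h => exact necessaryBound_antiI_sym h
  | antiTau_self τ h0 h1 => exact necessaryBound_antiTau_self h0 h1
  | antiTau_self_c τ h0 h1 => exact necessaryBound_antiTau_self_c h0 h1
  | diagSign α ω σ hσ h => exact necessaryBound_diagSign α ω σ
  | diagOne_self_c => exact necessaryBound_diagOne_self_c
  | diagNeg_self_c => exact necessaryBound_diagNeg_self_c
  | rankOne α hα => exact necessaryBound_rankOne hα
  | swap_diagNeg => exact necessaryBound_swap_diagNeg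

lemma exists_bound_rankOne_c :
    ∃ ν : ℝ, 0 < ν ∧ ∀ (c : Circle) (P : GL (Fin 2) ℂ),
      ‖(c : ℂ) - 1‖ ≤ ν * ‖pert !![1, 0; 0, 0] !![1, 0; 0, 0] c P‖ := by
  refine ⟨4, by norm_num, fun c P => ?_⟩
  obtain ⟨h00, -⟩ := (norm_pert_le_iff 1 0 0 0 1 0 0 0 c P (norm_nonneg _)).1 le_rfl
  refine norm_sub_one_le_of_nonneg (r := ‖(P : Mat2) 0 0‖ ^ 2) (Circle.norm_coe c)
    (by positivity) ?_
  convert h00 using 2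
  push_cast
  rw [← Complex.mul_conj']
  ring

/-! ### Partial converses -/

/-- The conclusion of the converse for a line of the table. -/
def ConverseBound (B A : Mat2) (free : Prop) (F : Exprs) : Prop :=
  ∃ ρ : ℝ, 0 < ρ ∧ ∀ (s : ℝ), 0 < s → s ≤ 1 →
    ∀ (c : Circle) (P : GL (Fin 2) ℂ) (k : ℤ), (free ∨ (c : ℂ) = (-1) ^ k) →
      BoundedBy F c P k s → ‖pert B A c P‖ ≤ ρ * √s

lemma converseBound_diagTheta (α : ℂ) {θ : ℝ} (hα : α = 0 ∨ α = 1) (h0 : 0 ≤ θ)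
    (h1 : θ < Real.pi) :
    ConverseBound !![α, 0; 0, 0] !![1, 0; 0, Complex.exp (θ * Complex.I)] True
      (fun c x y u v _ =>
        [(‖x‖ : ℂ) ^ 2 + Complex.exp (θ * Complex.I) * (‖u‖ : ℂ) ^ 2 - c⁻¹ * α, y ^ 2, v ^ 2]) := by
  have hκ := cos_half_pos h0 h1
  have hlow := cos_half_mul_le θ
  have hw := Complex.norm_exp_ofReal_mul_I θ
  generalize Complex.exp (θ * Complex.I) = w at *
  generalize Real.cos (θ / 2) = κ at *
  refine exists_converse_bound (2 + 2 * √(2 / κ)) (by positivity) ?_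
  intro c x y u v k s hc hs hs2 hs1 _ hF
  simp only [List.forall_mem_cons, List.not_mem_nil, false_imp_iff, implies_true, and_true,
    norm_pow] at hF
  obtain ⟨hx, hy, hv⟩ := hF
  replace hy : ‖y‖ ≤ √s := Real.le_sqrt_of_sq_le hy
  replace hv : ‖v‖ ≤ √s := Real.le_sqrt_of_sq_le hv
  -- The form at `(x, u)` is within `s ≤ 1` of a number of modulus at most `1`, so `x` and `u` stay
  -- bounded. The mixed entries are then of order `√s`, since only `y ^ 2` and `v ^ 2` are of order
  -- `s`.
  have hxu : ‖x‖ ^ 2 + ‖u‖ ^ 2 ≤ 2 / κ := by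
    rw [le_div_iff₀ hκ, mul_comm]
    refine (hlow _ _).trans ?_
    have e1 : ((‖x‖ ^ 2 : ℝ) : ℂ) + w * ((‖u‖ ^ 2 : ℝ) : ℂ) =
        ((‖x‖ : ℂ) ^ 2 + w * (‖u‖ : ℂ) ^ 2 - c⁻¹ * α) + c⁻¹ * α := by
      push_cast
      ring
    rw [e1]
    refine (norm_add_le_of_le hx (r₂ := 1) ?_).trans (by linarith)
    rw [norm_mul, norm_inv, hc, inv_one, one_mul]
    exact norm_le_one_of_eq hα
  have hx' : ‖x‖ ≤ √(2 / κ) := Real.le_sqrt_of_sq_le (by nlinarith [sq_nonneg ‖u‖])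
  have hu' : ‖u‖ ≤ √(2 / κ) := Real.le_sqrt_of_sq_le (by nlinarith [sq_nonneg ‖x‖])
  have hR := Real.sqrt_nonneg (2 / κ)
  have ht := Real.sqrt_nonneg s
  have ht1 : √s ≤ 1 := Real.sqrt_le_one.2 hs1
  generalize √(2 / κ) = R at *
  generalize √s = t at *
  have hRt := mul_nonneg hR ht
  have a1 := mul_le_mul hx' hy (norm_nonneg _) hR
  have a2 := mul_le_mul hu' hv (norm_nonneg _) hR
  have a3 := mul_le_mul hy hy (norm_nonneg _) ht
  have a4 := mul_le_mul hv hv (norm_nonneg _) ht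
  have a5 : t * t ≤ t := mul_le_of_le_one_right ht ht1
  refine ⟨?_, ?_, ?_, ?_⟩
  · refine le_trans (le_of_eq ?_) (hx.trans (by nlinarith only [hs2, hRt, ht]))
    rw [← Complex.mul_conj', ← Complex.mul_conj']
    congr 1
    ring
  · have e1 : conj x * (1 * y + 0 * v) + conj u * (0 * y + w * v) - c⁻¹ * 0 =
        conj x * y + w * (conj u * v) := by ring
    rw [e1]
    refine (norm_add_le _ _).trans ?_
    rw [norm_mul, norm_mul, norm_mul, hw, Complex.norm_conj, Complex.norm_conj]
    linarith
  · have e1 : conj y * (1 * x + 0 * u) + conj v * (0 * x + w * u) - c⁻¹ * 0 =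
        x * conj y + w * (u * conj v) := by ring
    rw [e1]
    refine (norm_add_le _ _).trans ?_
    rw [norm_mul, norm_mul, norm_mul, hw, Complex.norm_conj, Complex.norm_conj]
    linarith
  · have e1 : conj y * (1 * y + 0 * v) + conj v * (0 * y + w * v) - c⁻¹ * 0 =
        y * conj y + w * (v * conj v) := by ring
    rw [e1]
    refine (norm_add_le _ _).trans ?_
    rw [norm_mul, norm_mul, norm_mul, hw, Complex.norm_conj, Complex.norm_conj]
    linarith

lemma converseBound_antiTau (α : ℂ) {τ : ℝ} (h0 : 0 ≤ τ) (h1 : τ < 1) :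
    ConverseBound !![α, 0; 0, 0] !![0, 1; (τ : ℂ), 0] True
      (fun c x y u v _ =>
        [conj y * v, conj x * v, conj u * y,
          (1 + τ) * ((conj x * u).re : ℂ) + Complex.I * (1 - τ) * ((conj x * u).im : ℂ)
            - α / c]) := by
  refine exists_converse_bound 2 (by norm_num) ?_
  intro c x y u v k s hc hs hs2 hs1 _ hF
  simp only [List.forall_mem_cons, List.not_mem_nil, false_imp_iff, implies_true, and_true] at hF
  obtain ⟨hyv, hxv, huy, hxu⟩ := hF
  have key : ∀ z w : ℂ, ‖z‖ ≤ s → ‖w‖ ≤ s → ‖z + τ * conj w‖ ≤ 2 * √s := by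
    intro z w hz hw
    refine (norm_add_le _ _).trans ?_
    rw [norm_mul, Complex.norm_conj, Complex.norm_real, Real.norm_of_nonneg h0]
    nlinarith [norm_nonneg w]
  have hyu : ‖conj y * u‖ ≤ s := by
    rw [← Complex.norm_conj]
    convert huy using 2
    simp
    ring
  refine ⟨?_, ?_, ?_, ?_⟩
  · refine le_trans (le_of_eq ?_) (hxu.trans (by linarith))
    rw [anti_entry_eq]
    congr 1
    simp
    ring
  · refine le_trans (le_of_eq ?_) (key _ _ hxv hyu)
    congr 1
    simp
    ring
  · refine le_trans (le_of_eq ?_) (key _ _ hyu hxv)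
    congr 1
    simp
    ring
  · refine le_trans (le_of_eq ?_) (key _ _ hyv hyv)
    congr 1
    simp
    ring

lemma converseBound_swap {α β ω : ℂ} (hβ : conj β = β) :
    ConverseBound !![α, β; β, ω] swap (!![α, β; β, ω] = (0 : Mat2))
      (fun _ x y u v k =>
        [2 * ((conj y * v).re : ℂ) - (-1) ^ k * ω, 2 * ((conj x * u).re : ℂ) - (-1) ^ k * α,
          (conj x * v + conj u * y) - (-1) ^ k * β]) := by
  refine exists_converse_bound 1 one_pos ?_
  intro c x y u v k s hc hs hs2 hs1 hck hF
  simp only [List.forall_mem_cons, List.not_mem_nil, false_imp_iff, implies_true, and_true] at hF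
  -- For a zero target `c` plays no role; otherwise `c⁻¹` is the sign itself.
  have hsign : (α = 0 ∧ β = 0 ∧ ω = 0) ∨ c⁻¹ = (-1) ^ k := by
    rcases hck with h | h
    · left
      exact ⟨congrFun (congrFun h 0) 0, congrFun (congrFun h 0) 1, congrFun (congrFun h 1) 1⟩
    · right
      rw [inv_eq_conj hc, h]
      simp
  obtain ⟨hα', hβ', hω'⟩ : c⁻¹ * α = (-1) ^ k * α ∧ c⁻¹ * β = (-1) ^ k * β ∧
      c⁻¹ * ω = (-1) ^ k * ω := by
    rcases hsign with ⟨rfl, rfl, rfl⟩ | h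
    · simp
    · simp [h]
  obtain ⟨hyv, hxu, hxv⟩ := hF
  replace hs2 : s ≤ 1 * √s := by rwa [one_mul]
  unfold EntryBound
  rw [hα', hβ', hω']
  refine ⟨le_trans (le_of_eq ?_) (hxu.trans hs2), le_trans (le_of_eq ?_) (hxv.trans hs2), ?_,
    le_trans (le_of_eq ?_) (hyv.trans hs2)⟩
  · rw [two_mul_re]
    congr 1
    simp
    ring
  · congr 1
    ring
  · rw [← Complex.norm_conj]
    refine le_trans (le_of_eq ?_) (hxv.trans hs2)
    congr 1
    simp [hβ]
    ring
  · rw [two_mul_re]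
    congr 1
    simp
    ring

lemma converseBound_antiI (α : ℂ) :
    ConverseBound !![α, 0; 0, 0] !![0, 1; 1, Complex.I] True
      (fun c x y u v _ =>
        [conj x * v + conj u * y, conj u * v, ((conj y * v).re : ℂ), v ^ 2,
          2 * ((conj x * u).re : ℂ) + Complex.I * (‖u‖ : ℂ) ^ 2 - α / c]) := by
  refine exists_converse_bound 3 (by norm_num) ?_
  intro c x y u v k s hc hs hs2 hs1 _ hF
  simp only [List.forall_mem_cons, List.not_mem_nil, false_imp_iff, implies_true, and_true] at hF
  obtain ⟨hh, hg, hyv, hv, hxu⟩ := hF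
  have key : ∀ z w : ℂ, ‖z‖ ≤ s → ‖w‖ ≤ s → ‖z + Complex.I * w‖ ≤ 3 * √s := by
    intro z w hz hw
    refine (norm_add_le _ _).trans ?_
    rw [norm_mul, Complex.norm_I]
    linarith
  refine ⟨?_, ?_, ?_, ?_⟩
  · refine le_trans (le_of_eq ?_) (hxu.trans (by linarith))
    rw [two_mul_re, ← Complex.mul_conj']
    congr 1
    simp
    ring
  · refine le_trans (le_of_eq ?_) (key _ _ hh hg)
    congr 1
    ring
  · refine le_trans (le_of_eq ?_) (key _ _ ((Complex.norm_conj _).trans_le hh)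
      ((Complex.norm_conj _).trans_le hg))
    congr 1
    simp
    ring
  · have e1 : conj y * (0 * y + 1 * v) + conj v * (1 * y + Complex.I * v) - c⁻¹ * 0 =
        2 * ((conj y * v).re : ℂ) + Complex.I * (conj v * v) := by
      rw [two_mul_re]
      simp
      ring
    rw [e1]
    refine (norm_add_le _ _).trans ?_
    rw [norm_mul, norm_mul, norm_mul, Complex.norm_two, Complex.norm_I, Complex.norm_conj]
    rw [norm_pow, sq] at hv
    linarith

lemma ConvLine.converseBound {B A : Mat2} {free : Prop} {F : Exprs} (h : ConvLine B A free F) :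
    ConverseBound B A free F := by
  cases h with
  | diagTheta α θ hα h0 h1 => exact converseBound_diagTheta α hα h0 h1
  | antiTau α τ hα h0 h1 => exact converseBound_antiTau α h0 h1
  | swap α β ω h =>
    refine converseBound_swap ?_
    rcases h with ⟨-, -, rfl⟩ | ⟨rfl, -⟩ <;> simp
  | antiI α hα => exact converseBound_antiI α

end StarAction

theorem lemma3p4 :
    -- the vertices: every orbit contains exactly one of the normal forms
    (∀ M : StarAction.Mat2, ∃! V : StarAction.Vertex, M ∈ StarAction.orb V.mat) ∧
    -- the edges: the drawn arrows, together with trivial paths and compositions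
    (∀ V W : StarAction.Vertex, StarAction.Path V.mat W.mat ↔
      Relation.ReflTransGen StarAction.Vertex.Arrow V W) ∧
    -- the dimensions of the orbits
    (∀ V : StarAction.Vertex, StarAction.HasOrbitDim V.mat V.level) ∧
    -- `[0 1; 1 0]` represents the orbit of `1 ⊕ -1`
    StarAction.swap ∈ StarAction.orb StarAction.Vertex.diagNeg.mat ∧
    -- lower bounds where there is no path
    (∀ B A : StarAction.Mat2, StarAction.IsRep B → StarAction.IsRep A →
      ¬ StarAction.Path B A →
      ∃ μ : ℝ, 0 < μ ∧ ∀ (c : Circle) (P : GL (Fin 2) ℂ), μ ≤ ‖StarAction.pert B A c P‖) ∧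
    -- necessary conditions where there is a path
    (∀ (B A : StarAction.Mat2) (F : StarAction.Exprs), StarAction.Line B A F →
      StarAction.Path B A →
      ∃ ν : ℝ, 0 < ν ∧ ∀ (c : Circle) (P : GL (Fin 2) ℂ), StarAction.Small B A c P →
        ∃ k : ℤ, StarAction.BoundedBy F c P k (ν * ‖StarAction.pert B A c P‖)) ∧
    (∃ ν : ℝ, 0 < ν ∧ ∀ (c : Circle) (P : GL (Fin 2) ℂ),
      ‖StarAction.pert !![1, 0; 0, 0] !![1, 0; 0, 0] c P‖ ≤ 1 / 2 →
        ‖(c : ℂ) - 1‖ ≤ ν * ‖StarAction.pert !![1, 0; 0, 0] !![1, 0; 0, 0] c P‖) ∧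
    -- partial converses
    (∀ (B A : StarAction.Mat2) (free : Prop) (F : StarAction.Exprs),
      StarAction.ConvLine B A free F → StarAction.Path B A →
      ∃ ρ : ℝ, 0 < ρ ∧ ∀ (s : ℝ), 0 < s → s ≤ 1 →
        ∀ (c : Circle) (P : GL (Fin 2) ℂ) (k : ℤ), (free ∨ (c : ℂ) = (-1) ^ k) →
          StarAction.BoundedBy F c P k s →
            ‖StarAction.pert B A c P‖ ≤ ρ * Real.sqrt s) := by
  refine ⟨fun M => ?_, StarAction.path_iff_reflTransGen, StarAction.hasOrbitDim_vertex,
    StarAction.swap_mem_orb, fun B A _ _ h => StarAction.exists_lower_bound h,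
    fun B A F h _ => h.necessaryBound, ?_, fun B A free F h _ => h.converseBound⟩
  · obtain ⟨V, hV⟩ := StarAction.exists_vertex M
    exact ⟨V, hV, fun W hW => StarAction.vertex_unique hW hV⟩
  · obtain ⟨ν, hν, h⟩ := StarAction.exists_bound_rankOne_c
    exact ⟨ν, hν, fun c P _ => h c P⟩
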